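/- Setting. A (finite) operational-probabilistic theory is a symmetric monoidal category whose objects are systems and whose morphisms $\mathrm A\to\mathrm B$ are transformations; states of $\mathrm A$ are transformations from the trivial system $\mathrm I$ to $\mathrm A$, effects on $\mathrm A$ are transformations from $\mathrm A$ to $\mathrm I$, and the transformations of $\mathrm I$ are identified with the probabilities in $[0,1]$. Certain finite families of transformations (tests) are singled out; every transformation belongs to a test, tests are closed under sequential and parallel composition and under coarse-graining (joining outcomes, i.e. summing the corresponding transformations), the tests of $\mathrm I$ are the probability distributions, and the identities and structural isomorphisms are deterministic (one-outcome tests, also called channels). Two transformations are equal if they have the same probabilities in all circuits. For each system the states span a finite-dimensional real vector space and form a closed set. The theory is causal: each system has a unique deterministic effect $u$, and a test may be chosen depending on the outcome of an earlier test. Write $(a|\rho)$ for the probability of the effect $a$ on the state $\rho$; the norm of a state is $\sup_a (a|\rho)$, that of an effect is $\sup_\rho (a|\rho)$, and normalised means norm $1$. A transformation $\mathcal C$ is pure if all its refinements are of the form $\mathcal D_j=p_j\mathcal C$ with $\{p_j\}$ a probability distribution. A normalised pure state $\Psi$ of $\mathrm A\otimes\mathrm B$ is a purification of $\rho$ if discarding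 $\mathrm B$ with $u$ gives $\rho$. A sharp theory with purification is a causal theory such that: sequential and parallel compositions of pure transformations are pure; on every system some pure effect occurs with probability $1$ on some state; every normalised state has a purification, and any two purifications of the same state with the same purifying system $\mathrm B$ differ by a reversible channel on $\mathrm B$. A family of states $\{\rho_i\}$ is perfectly distinguishable if there is an observation-test $\{a_i\}$ with $(a_i|\rho_j)=\delta_{ij}$; a pure maximal set is a perfectly distinguishable family of pure states to which no state can be added while keeping perfect distinguishability. For a normalised pure state $\alpha$, $\alpha^\dagger$ denotes the unique normalised pure effect with $(\alpha^\dagger|\alpha)=1$. Proposition. Let $\{\alpha_i\}_{i=1}^d$ be a pure maximal set of a system $\mathrm A$ in a sharp theory with purification. Then each $\alpha_i^\dagger$ exists (and is unique), and the following holds for every subset $\mathsf I\subseteq\{1,\dots,d\}$. Put $a_{\mathsf I}:=\sum_{i\in\mathsf I}\alpha_i^\dagger$, and let $$F_{\mathsf I}=\{\rho \text{ a normalised state of } \mathrm A: (a_{\mathsf I}|\rho)=1\},\qquad F_{\mathsf I}^{\perp}=\{\rho \text{ a normalised state of } \mathrm A: (a_{\mathsf I}|\rho)=0\}.$$ There is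 a pure transformation $P_{\mathsf I}$ from $\mathrm A$ to $\mathrm A$ that is an orthogonal projector on $F_{\mathsf I}$, that is, $P_{\mathsf I}\rho=\rho$ for every $\rho\in F_{\mathsf I}$ and $P_{\mathsf I}\rho=0$ for every $\rho\in F_{\mathsf I}^{\perp}$, and that satisfies $uP_{\mathsf I}=a_{\mathsf I}$. -/

import Mathlib

open CategoryTheory MonoidalCategory

universe v u

namespace OPT

/-- The raw data of an operational-probabilistic theory on a symmetric monoidal category `C`.
Objects are systems, `𝟙_ C` is the trivial system, and morphisms `A ⟶ B` are the transformations
from `A` to `B`; states of `A` are morphisms `𝟙_ C ⟶ A` and effects on `A` are morphisms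
`A ⟶ 𝟙_ C`. Composition is written in diagrammatic order, so that `ρ ≫ f ≫ a` is the circuit
usually written `(a| f |ρ)`. -/
structure CircuitData (C : Type u) [Category.{v} C] [MonoidalCategory C] where
  /-- The probability of a circuit without external wires. -/
  prob : (𝟙_ C ⟶ 𝟙_ C) → ℝ
  /-- `IsTest f` says that the transformations `f x`, with `x` ranging over the outcome set `X`,
  form a test. -/
  IsTest : ∀ {A B : C} {X : Type}, (X → (A ⟶ B)) → Prop

namespace CircuitData

variable {C : Type u} [Category.{v} C] [MonoidalCategory C] (T : CircuitData C)

/-- The pairing `(a|ρ)`: the probability that the effect `a` occurs on the state `ρ`. -/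
def pair {A : C} (a : A ⟶ 𝟙_ C) (ρ : 𝟙_ C ⟶ A) : ℝ := T.prob (ρ ≫ a)

/-- A state as a vector, through its probabilities on all effects. The span of these vectors is
the real vector space of the system. -/
def stateVec {A : C} (ρ : 𝟙_ C ⟶ A) : (A ⟶ 𝟙_ C) → ℝ := fun a => T.pair a ρ

/-- An effect as a vector, through its probabilities on all states. -/
def effectVec {A : C} (a : A ⟶ 𝟙_ C) : (𝟙_ C ⟶ A) → ℝ := fun ρ => T.pair a ρ

/-- A transformation as a vector, through the probabilities of all closed circuits in which it
occurs (next to an arbitrary ancilla `S`). Sums and multiples of transformations are sums and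
multiples of these vectors. -/
def vec {A B : C} (f : A ⟶ B) :
    ∀ S : C, (𝟙_ C ⟶ A ⊗ S) → (B ⊗ S ⟶ 𝟙_ C) → ℝ :=
  fun S σ e => T.prob (σ ≫ (f ▷ S) ≫ e)

/-- A channel is a deterministic transformation: it forms a test on its own. -/
def IsChannel {A B : C} (f : A ⟶ B) : Prop := T.IsTest (fun _ : Unit => f)

/-- A reversible channel: a channel with a two-sided inverse that is a channel. -/
def IsReversible {A B : C} (f : A ⟶ B) : Prop :=
  T.IsChannel f ∧ ∃ g : B ⟶ A, T.IsChannel g ∧ f ≫ g = 𝟙 A ∧ g ≫ f = 𝟙 B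

/-- The test `c` is the coarse-graining of the test `f` in which the outcomes are joined along the
surjection `π`: the blocks of the partition of `Y` are the fibres of `π`. -/
def IsCoarseGraining {A B : C} {X Y : Type} (c : X → (A ⟶ B)) (f : Y → (A ⟶ B)) (π : Y → X) :
    Prop :=
  T.IsTest c ∧ T.IsTest f ∧ Function.Surjective π ∧
    ∀ x, T.vec (c x) = ∑ᶠ y ∈ π ⁻¹' {x}, T.vec (f y)

/-- A transformation is pure if all its refinements are trivial: whenever it is the outcome `x` of
a coarse-graining `c` of a test `f`, the transformations in the corresponding block of `f` are
`p y` times it, for a probability distribution `p` on that block. -/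
def IsPure {A B : C} (g : A ⟶ B) : Prop :=
  ∀ (X Y : Type) (c : X → (A ⟶ B)) (f : Y → (A ⟶ B)) (π : Y → X),
    T.IsCoarseGraining c f π → ∀ x, c x = g →
      ∃ p : Y → ℝ, (∀ y ∈ π ⁻¹' {x}, 0 ≤ p y) ∧ ∑ᶠ y ∈ π ⁻¹' {x}, p y = 1 ∧
        ∀ y ∈ π ⁻¹' {x}, T.vec (f y) = p y • T.vec g

/-- The operational norm of a state. -/
noncomputable def stateNorm {A : C} (ρ : 𝟙_ C ⟶ A) : ℝ := ⨆ a : A ⟶ 𝟙_ C, T.pair a ρ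

/-- The operational norm of an effect. -/
noncomputable def effectNorm {A : C} (a : A ⟶ 𝟙_ C) : ℝ := ⨆ ρ : 𝟙_ C ⟶ A, T.pair a ρ

open Classical in
/-- Perfectly distinguishable states. -/
def PerfectlyDistinguishable {A : C} {X : Type} (ρ : X → (𝟙_ C ⟶ A)) : Prop :=
  ∃ a : X → (A ⟶ 𝟙_ C), T.IsTest a ∧ ∀ i j, T.pair (a i) (ρ j) = if i = j then 1 else 0

/-- A pure maximal set: perfectly distinguishable pure states to which no further state can be
adjoined without losing perfect distinguishability. -/
def IsPureMaximal {A : C} {X : Type} (α : X → (𝟙_ C ⟶ A)) : Prop :=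
  (∀ i, T.IsPure (α i)) ∧ T.PerfectlyDistinguishable α ∧
    ¬ ∃ ρ₀ : 𝟙_ C ⟶ A, T.PerfectlyDistinguishable (fun i : Option X => i.elim ρ₀ α)

/-- `a` is the dagger of the state `α`: the unique normalised pure effect with `(a|α) = 1`. -/
def IsDagger {A : C} (α : 𝟙_ C ⟶ A) (a : A ⟶ 𝟙_ C) : Prop :=
  (T.IsPure a ∧ T.effectNorm a = 1 ∧ T.pair a α = 1) ∧
    ∀ b : A ⟶ 𝟙_ C, T.IsPure b → T.effectNorm b = 1 → T.pair b α = 1 → b = a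

/-- The face of the normalised states on which the vector `e` (a combination of effects) takes the
value one. -/
def face {A : C} (e : (𝟙_ C ⟶ A) → ℝ) : Set (𝟙_ C ⟶ A) :=
  {ρ | T.stateNorm ρ = 1 ∧ e ρ = 1}

/-- The orthogonal face: the normalised states on which `e` takes the value zero. -/
def orthFace {A : C} (e : (𝟙_ C ⟶ A) → ℝ) : Set (𝟙_ C ⟶ A) :=
  {ρ | T.stateNorm ρ = 1 ∧ e ρ = 0}

/-- `P` is an orthogonal projector on the face defined by `e`: it fixes the states of the face and
sends the states of the orthogonal face to zero. -/
def IsOrthogonalProjector {A : C} (e : (𝟙_ C ⟶ A) → ℝ) (P : A ⟶ A) : Prop :=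
  (∀ ρ ∈ T.face e, ρ ≫ P = ρ) ∧ ∀ ρ ∈ T.orthFace e, T.stateVec (ρ ≫ P) = 0

end CircuitData

/-- Operational-probabilistic theories with finite systems and closed sets of states. -/
structure OperationalTheory (C : Type u) [Category.{v} C] [MonoidalCategory C]
    [SymmetricCategory C] extends CircuitData C where
  /-- Scalars are probabilities. -/
  prob_mem : ∀ s : 𝟙_ C ⟶ 𝟙_ C, prob s ∈ Set.Icc (0 : ℝ) 1
  exists_prob_eq : ∀ r ∈ Set.Icc (0 : ℝ) 1, ∃ s : 𝟙_ C ⟶ 𝟙_ C, prob s = r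
  prob_comp : ∀ s t : 𝟙_ C ⟶ 𝟙_ C, prob (s ≫ t) = prob s * prob t
  /-- The tests of the trivial system are the probability distributions. -/
  isTest_scalar_iff : ∀ {X : Type} [Fintype X] (s : X → (𝟙_ C ⟶ 𝟙_ C)),
    IsTest s ↔ ∑ x, prob (s x) = 1
  /-- Tests have finitely many outcomes. -/
  finite_of_isTest : ∀ {A B : C} {X : Type} (f : X → (A ⟶ B)), IsTest f → Finite X
  /-- Every transformation occurs in a test. -/
  exists_isTest : ∀ {A B : C} (g : A ⟶ B),
    ∃ (X : Type) (f : X → (A ⟶ B)) (x : X), IsTest f ∧ f x = g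
  /-- Identities, swaps, and the identifications of bracketings are channels. -/
  isChannel_id : ∀ A : C, toCircuitData.IsChannel (𝟙 A)
  isChannel_swap : ∀ A B : C, toCircuitData.IsChannel (β_ A B).hom
  isChannel_assoc : ∀ A B D : C, toCircuitData.IsChannel (α_ A B D).hom
  isChannel_assoc_inv : ∀ A B D : C, toCircuitData.IsChannel (α_ A B D).inv
  isChannel_left : ∀ A : C, toCircuitData.IsChannel (λ_ A).hom
  isChannel_left_inv : ∀ A : C, toCircuitData.IsChannel (λ_ A).inv
  isChannel_right : ∀ A : C, toCircuitData.IsChannel (ρ_ A).hom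
  isChannel_right_inv : ∀ A : C, toCircuitData.IsChannel (ρ_ A).inv
  /-- Sequential and parallel compositions of tests are tests. -/
  isTest_comp : ∀ {A B D : C} {X Y : Type} (f : X → (A ⟶ B)) (g : Y → (B ⟶ D)),
    IsTest f → IsTest g → IsTest (fun z : X × Y => f z.1 ≫ g z.2)
  isTest_tensor : ∀ {A B A' B' : C} {X Y : Type} (f : X → (A ⟶ B)) (g : Y → (A' ⟶ B')),
    IsTest f → IsTest g → IsTest (fun z : X × Y => f z.1 ⊗ₘ g z.2)
  /-- The outcomes of a test can be joined. -/
  exists_coarseGraining : ∀ {A B : C} {X Y : Type} (f : Y → (A ⟶ B)) (π : Y → X),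
    IsTest f → Function.Surjective π →
      ∃ c : X → (A ⟶ B), toCircuitData.IsCoarseGraining c f π
  /-- Transformations that have the same probabilities in all circuits are equal. -/
  vec_injective : ∀ {A B : C} (f g : A ⟶ B),
    toCircuitData.vec f = toCircuitData.vec g → f = g
  /-- Systems are finite: states span a finite-dimensional vector space. -/
  finiteDimensional : ∀ A : C, FiniteDimensional ℝ
    (Submodule.span ℝ (Set.range (fun ρ : 𝟙_ C ⟶ A => toCircuitData.stateVec ρ)))
  /-- The set of states is closed. -/
  isClosed_states : ∀ A : C,
    IsClosed (Set.range (fun ρ : 𝟙_ C ⟶ A => toCircuitData.stateVec ρ))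

/-- Causal theories: every system has a unique deterministic effect. As later tests have no
influence on earlier outcomes, the choice of a test may depend on the outcome of an earlier one. -/
structure CausalTheory (C : Type u) [Category.{v} C] [MonoidalCategory C]
    [SymmetricCategory C] extends OperationalTheory C where
  /-- The deterministic effect. -/
  unit : ∀ A : C, A ⟶ 𝟙_ C
  isChannel_unit : ∀ A : C, toCircuitData.IsChannel (unit A)
  eq_unit : ∀ {A : C} (e : A ⟶ 𝟙_ C), toCircuitData.IsChannel e → e = unit A
  isTest_conditional : ∀ {A B D : C} {X : Type} {Y : X → Type} (f : X → (A ⟶ B))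
    (g : ∀ x, Y x → (B ⟶ D)), IsTest f → (∀ x, IsTest (g x)) →
      IsTest (fun z : Σ x, Y x => f z.1 ≫ g z.1 z.2)

namespace CausalTheory

variable {C : Type u} [Category.{v} C] [MonoidalCategory C] [SymmetricCategory C]
  (T : CausalTheory C)

/-- The marginal on `A` of a state of `A ⊗ B`. -/
def marginal {A B : C} (Ψ : 𝟙_ C ⟶ A ⊗ B) : 𝟙_ C ⟶ A :=
  Ψ ≫ (A ◁ T.unit B) ≫ (ρ_ A).hom

/-- `Ψ` is a purification of `ρ`, with purifying system `B`. -/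
def IsPurification {A B : C} (Ψ : 𝟙_ C ⟶ A ⊗ B) (ρ : 𝟙_ C ⟶ A) : Prop :=
  T.IsPure Ψ ∧ T.stateNorm Ψ = 1 ∧ T.marginal Ψ = ρ

/-- Sharp theories with purification: the causal theories that satisfy Purity Preservation,
Pure Sharpness, and Purification. -/
structure IsSharpWithPurification : Prop where
  pure_comp : ∀ {A B D : C} (f : A ⟶ B) (g : B ⟶ D),
    T.IsPure f → T.IsPure g → T.IsPure (f ≫ g)
  pure_tensor : ∀ {A B A' B' : C} (f : A ⟶ B) (g : A' ⟶ B'),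
    T.IsPure f → T.IsPure g → T.IsPure (f ⊗ₘ g)
  pure_sharpness : ∀ A : C, ∃ a : A ⟶ 𝟙_ C, T.IsPure a ∧ ∃ ρ : 𝟙_ C ⟶ A, T.pair a ρ = 1
  exists_purification : ∀ {A : C} (ρ : 𝟙_ C ⟶ A), T.stateNorm ρ = 1 →
    ∃ (B : C) (Ψ : 𝟙_ C ⟶ A ⊗ B), T.IsPurification Ψ ρ
  purification_unique : ∀ {A B : C} (ρ : 𝟙_ C ⟶ A) (Ψ Ψ' : 𝟙_ C ⟶ A ⊗ B),
    T.IsPurification Ψ ρ → T.IsPurification Ψ' ρ →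
      ∃ U : B ⟶ B, T.IsReversible U ∧ Ψ' = Ψ ≫ (A ◁ U)

end CausalTheory

end OPT

/-!
A pure transformation `P` is wanted that fixes the states on which `a = ∑ i ∈ I, α i†` is certain
and has `u P = a`. The proof has three ingredients.

*Pure effects and pure states determine each other.* If a pure effect is certain on `ρ`, then it
acts on a purification of `ρ` like the deterministic effect; so the other marginal is pure, the
purification is a product, and `ρ` is pure (`isPure_of_pair_eq_one`). Extremality makes `ρ` unique.
For the converse, let `χ` be a state invariant under all reversible channels. It exists by a fixed
point argument: a positive definite quadratic form, maximised over the group, has a unique minimum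
on the compact convex set of states (`exists_fixed_of_isCompact`). The argument is applied to the
states on which the effects in the orbit of a pure effect are bounded away from zero, so that the
latter has nonzero probability on `χ` (`exists_invariant_state`). Since reversible channels are
transitive on pure states, all pure effects that are certain on some state have the same
probability `p` on `χ`. On a purification `Φ` of `χ` each of them is perfectly correlated with a
pure effect of the purifying system that prepares `p` times the corresponding state
(`exists_invariant_purification`). As pure states separate effects, `Φ` is faithful for effects,
and only one pure effect is certain on a given state (`effect_eq_of_pair_eq_one`).

*Non-disturbing transformations.* Removing from `χ` the part `p α` leaves a state that is perfectly
distinguishable from `α`, so every nontrivial system can serve as a register. Purifying a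
measurement that records its outcome in a register, and comparing it with `Φ`, shows that every
effect `a` is `u f` for a pure `f` (`exists_pure_test`). If `a` is certain on `ω`, then `f` leaves
the other marginal of a purification `Ψ` of `ω` unchanged. By uniqueness of purification `f` can be
followed by a pure transformation `g` such that `P = f ≫ g` fixes `Ψ`, and by steering `P` fixes
all components of `ω`. If the components of `ω` span the face of `a`, then `P` is pure, fixes the
whole face, and satisfies `u P ≤ a` (`exists_nondisturbing`).

*Invariance of the pure effects.* If `P` is pure and fixes `α`, then `α† P` is a pure effect that
is certain on `α`, so `α† P = α†`. Applied to the outcomes of a test that distinguishes the `α i`,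
this gives `(α i†| α j) = 0` for `i ≠ j`; applied to the complement of a partial sum of the `α i†`,
it allows one more of them to be added, so that `a` is an effect of the theory. Applied to the
transformation `P` of `a` itself it gives `a P = a`, hence `a = a P ≤ u P ≤ a`.
-/

/-! ### Circuits around a transformation, and manipulations of tests -/

namespace OPT

section Contexts

variable {C : Type u} [Category.{v} C] [MonoidalCategory C]

namespace CircuitData

variable (T : CircuitData C)

lemma vec_comp_left {A' A B : C} (h : A' ⟶ A) (f : A ⟶ B) (S : C) (σ : 𝟙_ C ⟶ A' ⊗ S)
    (e : B ⊗ S ⟶ 𝟙_ C) : T.vec (h ≫ f) S σ e = T.vec f S (σ ≫ h ▷ S) e := by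
  simp [vec]

lemma vec_comp_right {A B B' : C} (f : A ⟶ B) (k : B ⟶ B') (S : C) (σ : 𝟙_ C ⟶ A ⊗ S)
    (e : B' ⊗ S ⟶ 𝟙_ C) : T.vec (f ≫ k) S σ e = T.vec f S σ (k ▷ S ≫ e) := by
  simp [vec]

lemma vec_whiskerRight {A B : C} (f : A ⟶ B) (S' S : C) (σ : 𝟙_ C ⟶ (A ⊗ S') ⊗ S)
    (e : (B ⊗ S') ⊗ S ⟶ 𝟙_ C) : T.vec (f ▷ S') S σ e =
      T.vec f (S' ⊗ S) (σ ≫ (α_ _ _ _).hom) ((α_ _ _ _).inv ≫ e) := by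
  simp [vec]

lemma stateVec_eq_vec {A : C} (ρ : 𝟙_ C ⟶ A) (a : A ⟶ 𝟙_ C) :
    T.stateVec ρ a = T.vec ρ (𝟙_ C) (λ_ _).inv ((ρ_ A).hom ≫ a) := by
  simp [vec, stateVec, pair, ← unitors_equal]

lemma vec_eq_stateVec {A : C} (ρ : 𝟙_ C ⟶ A) (S : C) (σ : 𝟙_ C ⟶ 𝟙_ C ⊗ S)
    (e : A ⊗ S ⟶ 𝟙_ C) :
    T.vec ρ S σ e = T.stateVec ρ ((ρ_ A).inv ≫ A ◁ (σ ≫ (λ_ S).hom) ≫ e) := by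
  have : σ ≫ ρ ▷ S = ρ ≫ (ρ_ A).inv ≫ A ◁ (σ ≫ (λ_ S).hom) := by
    have h : σ = (ρ_ (𝟙_ C)).inv ≫ 𝟙_ C ◁ (σ ≫ (λ_ S).hom) := by
      simp [← unitors_inv_equal]
    rw [rightUnitor_inv_naturality_assoc, ← whisker_exchange, ← Category.assoc, ← h]
  simp only [vec, stateVec, pair]
  rw [← Category.assoc, this]
  simp

lemma effectVec_eq_vec {A : C} (a : A ⟶ 𝟙_ C) (ρ : 𝟙_ C ⟶ A) :
    T.effectVec a ρ = T.vec a (𝟙_ C) (ρ ≫ (ρ_ A).inv) (λ_ _).hom := by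
  simp [vec, effectVec, pair, unitors_equal]

lemma vec_eq_effectVec {A : C} (a : A ⟶ 𝟙_ C) (S : C) (σ : 𝟙_ C ⟶ A ⊗ S)
    (e : 𝟙_ C ⊗ S ⟶ 𝟙_ C) :
    T.vec a S σ e = T.effectVec a (σ ≫ A ◁ ((λ_ S).inv ≫ e) ≫ (ρ_ A).hom) := by
  have : (A ◁ ((λ_ S).inv ≫ e) ≫ (ρ_ A).hom) ≫ a = a ▷ S ≫ e := by
    rw [Category.assoc, ← rightUnitor_naturality, whisker_exchange_assoc]
    simp [← unitors_equal]
  simp only [vec, effectVec, pair, Category.assoc] at this ⊢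
  rw [this]

/-- Every circuit around `F f` is a circuit around `f`. -/
def Reindexes {A B A' B' : C} (F : (A ⟶ B) → (A' ⟶ B')) : Prop :=
  ∀ S σ e, ∃ S' σ' e', ∀ f, T.vec (F f) S σ e = T.vec f S' σ' e'

/-- An operation on transformations that is performed by placing them in a fixed circuit: it
preserves tests, and circuits around its output are circuits around its input. -/
def IsContext {A B A' B' : C} (F : (A ⟶ B) → (A' ⟶ B')) : Prop :=
  (∀ {X : Type} (f : X → (A ⟶ B)), T.IsTest f → T.IsTest (fun x => F (f x))) ∧ T.Reindexes F

variable {T}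

lemma Reindexes.vec_sum {A B A' B' : C} {F : (A ⟶ B) → (A' ⟶ B')} (hF : T.Reindexes F)
    {ι : Type*} {s : Finset ι} {c : ι → ℝ} {f : ι → (A ⟶ B)} {g : A ⟶ B}
    (h : T.vec g = ∑ i ∈ s, c i • T.vec (f i)) :
    T.vec (F g) = ∑ i ∈ s, c i • T.vec (F (f i)) := by
  funext S σ e
  obtain ⟨S', σ', e', h'⟩ := hF S σ e
  simp only [Finset.sum_apply, Pi.smul_apply, h', h]

lemma Reindexes.vec_sum_one {A B A' B' : C} {F : (A ⟶ B) → (A' ⟶ B')} (hF : T.Reindexes F)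
    {ι : Type*} {s : Finset ι} {f : ι → (A ⟶ B)} {g : A ⟶ B}
    (h : T.vec g = ∑ i ∈ s, T.vec (f i)) :
    T.vec (F g) = ∑ i ∈ s, T.vec (F (f i)) := by
  simpa using hF.vec_sum (c := fun _ => 1) (by simpa using h)

lemma Reindexes.vec_smul {A B A' B' : C} {F : (A ⟶ B) → (A' ⟶ B')} (hF : T.Reindexes F)
    {c : ℝ} {f g : A ⟶ B} (h : T.vec g = c • T.vec f) : T.vec (F g) = c • T.vec (F f) := by
  simpa using hF.vec_sum (s := {()}) (c := fun _ => c) (f := fun _ => f) (by simpa using h)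

lemma IsContext.comp {A B A' B' A'' B'' : C} {F : (A ⟶ B) → (A' ⟶ B')}
    {G : (A' ⟶ B') → (A'' ⟶ B'')} (hG : T.IsContext G) (hF : T.IsContext F) :
    T.IsContext (fun f => G (F f)) := by
  refine ⟨fun f hf => hG.1 _ (hF.1 f hf), fun S σ e => ?_⟩
  obtain ⟨S', σ', e', h⟩ := hG.2 S σ e
  obtain ⟨S'', σ'', e'', h'⟩ := hF.2 S' σ' e'
  exact ⟨S'', σ'', e'', fun f => by rw [h, h']⟩

variable (T)

lemma reindexes_comp {A B A' B' : C} (h : A' ⟶ A) (k : B ⟶ B') :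
    T.Reindexes (fun f : A ⟶ B => h ≫ f ≫ k) := fun S σ e =>
  ⟨S, σ ≫ h ▷ S, k ▷ S ≫ e, fun f => by rw [vec_comp_left, vec_comp_right]⟩

lemma reindexes_comp_left {A' A B : C} (h : A' ⟶ A) :
    T.Reindexes (fun f : A ⟶ B => h ≫ f) := fun S σ e =>
  ⟨S, σ ≫ h ▷ S, e, fun f => by rw [vec_comp_left]⟩

lemma reindexes_whiskerRight (A B S : C) :
    T.Reindexes (fun f : A ⟶ B => f ▷ S) := fun S' _ _ =>
  ⟨S ⊗ S', _, _, fun f => by rw [vec_whiskerRight]⟩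

lemma vec_state_sum {A : C} {ι : Type*} {s : Finset ι} {c : ι → ℝ} {f : ι → (𝟙_ C ⟶ A)}
    {g : 𝟙_ C ⟶ A} : T.vec g = ∑ i ∈ s, c i • T.vec (f i) ↔
      T.stateVec g = ∑ i ∈ s, c i • T.stateVec (f i) := by
  constructor
  · intro h
    funext a
    simp only [stateVec_eq_vec, Finset.sum_apply, Pi.smul_apply, h]
  · intro h
    funext S σ e
    simp only [vec_eq_stateVec, Finset.sum_apply, Pi.smul_apply, h]

lemma vec_state_smul {A : C} {c : ℝ} {f g : 𝟙_ C ⟶ A} : T.vec g = c • T.vec f ↔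
    T.stateVec g = c • T.stateVec f := by
  simpa using T.vec_state_sum (s := {()}) (c := fun _ => c) (f := fun _ => f) (g := g)

lemma vec_state_sum_one {A : C} {ι : Type*} {s : Finset ι} {f : ι → (𝟙_ C ⟶ A)}
    {g : 𝟙_ C ⟶ A} : T.vec g = ∑ i ∈ s, T.vec (f i) ↔
      T.stateVec g = ∑ i ∈ s, T.stateVec (f i) := by
  simpa using T.vec_state_sum (s := s) (c := fun _ => 1) (f := f) (g := g)

lemma vec_effect_sum_one {A : C} {ι : Type*} {s : Finset ι} {f : ι → (A ⟶ 𝟙_ C)}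
    {g : A ⟶ 𝟙_ C} : T.vec g = ∑ i ∈ s, T.vec (f i) ↔
      T.effectVec g = ∑ i ∈ s, T.effectVec (f i) := by
  constructor
  · intro h
    funext a
    simp only [effectVec_eq_vec, Finset.sum_apply, h]
  · intro h
    funext S σ e
    simp only [vec_eq_effectVec, Finset.sum_apply, h]

/-- For a test with finitely many outcomes the condition on a coarse-graining is about finite
sums. -/
lemma isCoarseGraining_iff {A B : C} {X Y : Type} [Fintype Y] [DecidableEq X]
    {c : X → (A ⟶ B)} {f : Y → (A ⟶ B)} {π : Y → X} :
    T.IsCoarseGraining c f π ↔ T.IsTest c ∧ T.IsTest f ∧ Function.Surjective π ∧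
      ∀ x, T.vec (c x) = ∑ y with π y = x, T.vec (f y) := by
  have : ∀ x, ∑ᶠ y ∈ π ⁻¹' {x}, T.vec (f y) = ∑ y with π y = x, T.vec (f y) := by
    intro x
    rw [← finsum_mem_coe_finset]
    congr 1; ext y; simp
  simp only [IsCoarseGraining, this]

end CircuitData

/-- Multiplication by a scalar, as a transformation. -/
def scale (s : 𝟙_ C ⟶ 𝟙_ C) (A : C) : A ⟶ A := (λ_ A).inv ≫ s ▷ A ≫ (λ_ A).hom

lemma comp_scale {A : C} (ρ : 𝟙_ C ⟶ A) (s : 𝟙_ C ⟶ 𝟙_ C) : ρ ≫ scale s A = s ≫ ρ := by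
  rw [scale, leftUnitor_inv_naturality_assoc, whisker_exchange_assoc, leftUnitor_naturality,
    unitors_inv_equal, ← rightUnitor_inv_naturality_assoc, unitors_equal]
  simp

lemma scale_whiskerRight (s : 𝟙_ C ⟶ 𝟙_ C) (A S : C) : scale s A ▷ S = scale s (A ⊗ S) := by
  simp [scale]

end Contexts

namespace OperationalTheory

variable {C : Type u} [Category.{v} C] [MonoidalCategory C] [SymmetricCategory C]
  (T : OperationalTheory C)

open CircuitData

lemma prob_nonneg (s : 𝟙_ C ⟶ 𝟙_ C) : 0 ≤ T.prob s := (T.prob_mem s).1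

lemma prob_le_one (s : 𝟙_ C ⟶ 𝟙_ C) : T.prob s ≤ 1 := (T.prob_mem s).2

lemma prob_id : T.prob (𝟙 (𝟙_ C)) = 1 := by
  simpa using (T.isTest_scalar_iff (fun _ : Unit => 𝟙 (𝟙_ C))).1 (T.isChannel_id _)

lemma eq_of_stateVec {A : C} {ρ σ : 𝟙_ C ⟶ A} (h : T.stateVec ρ = T.stateVec σ) : ρ = σ := by
  apply T.vec_injective
  have := (T.vec_state_smul (c := 1) (f := σ) (g := ρ)).2 (by simpa using h)
  simpa using this

lemma eq_of_effectVec {A : C} {a b : A ⟶ 𝟙_ C} (h : T.effectVec a = T.effectVec b) : a = b := by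
  apply T.vec_injective
  have := (T.vec_effect_sum_one (s := {()}) (f := fun _ => b) (g := a)).2 (by simpa using h)
  simpa using this

lemma eq_of_prob {s t : 𝟙_ C ⟶ 𝟙_ C} (h : T.prob s = T.prob t) : s = t := by
  apply T.eq_of_stateVec
  funext a
  simp [stateVec, pair, T.prob_comp, h]

lemma isTest_comp_equiv {A B : C} {X Y : Type} {f : Y → (A ⟶ B)} (hf : T.IsTest f) (e : X ≃ Y) :
    T.IsTest (fun x => f (e x)) := by
  obtain ⟨c, hc, -, -, h⟩ := T.exists_coarseGraining f e.symm hf e.symm.surjective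
  have : c = fun x => f (e x) := by
    funext x
    apply T.vec_injective
    have h1 : e.symm ⁻¹' {x} = {e x} := by ext y; simp [Equiv.symm_apply_eq]
    rw [h x, h1, finsum_mem_singleton]
  rwa [← this]

lemma isContext_comp {A B A' B' : C} {h : A' ⟶ A} {k : B ⟶ B'} (hh : T.IsChannel h)
    (hk : T.IsChannel k) : T.IsContext (fun f : A ⟶ B => h ≫ f ≫ k) := by
  refine ⟨fun {X} f hf => ?_, T.reindexes_comp h k⟩
  have := T.isTest_comp _ _ hh (T.isTest_comp _ _ hf hk)
  exact T.isTest_comp_equiv this ((Equiv.punitProd (X × Unit)).trans (Equiv.prodPUnit X)).symm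

lemma isContext_comp_right {A B B' : C} {k : B ⟶ B'} (hk : T.IsChannel k) :
    T.IsContext (fun f : A ⟶ B => f ≫ k) := by
  simpa using T.isContext_comp (T.isChannel_id A) hk

lemma isContext_comp_left {A' A B : C} {h : A' ⟶ A} (hh : T.IsChannel h) :
    T.IsContext (fun f : A ⟶ B => h ≫ f) := by
  simpa using T.isContext_comp hh (T.isChannel_id B)

lemma isContext_whiskerRight (A B S : C) : T.IsContext (fun f : A ⟶ B => f ▷ S) := by
  refine ⟨fun {X} f hf => ?_, T.reindexes_whiskerRight A B S⟩
  have := T.isTest_tensor _ _ hf (T.isChannel_id S)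
  simpa using T.isTest_comp_equiv this (Equiv.prodPUnit X).symm

lemma isContext_whiskerLeft (A B S : C) : T.IsContext (fun f : A ⟶ B => S ◁ f) := by
  have := (T.isContext_comp (T.isChannel_swap S A) (T.isChannel_swap B S)).comp
    (T.isContext_whiskerRight A B S)
  have h : ∀ f : A ⟶ B, (β_ S A).hom ≫ f ▷ S ≫ (β_ B S).hom = S ◁ f := fun f => by
    rw [BraidedCategory.braiding_naturality_left, SymmetricCategory.symmetry_assoc]
  simpa only [h] using this

variable {T}

lemma isCoarseGraining_context {A B A' B' : C} {F : (A ⟶ B) → (A' ⟶ B')} (hF : T.IsContext F)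
    {X Y : Type} {c : X → (A ⟶ B)} {f : Y → (A ⟶ B)} {π : Y → X}
    (h : T.IsCoarseGraining c f π) :
    T.IsCoarseGraining (fun x => F (c x)) (fun y => F (f y)) π := by
  classical
  have := T.finite_of_isTest f h.2.1
  have := Fintype.ofFinite Y
  rw [isCoarseGraining_iff] at h ⊢
  exact ⟨hF.1 _ h.1, hF.1 _ h.2.1, h.2.2.1, fun x => hF.2.vec_sum_one (h.2.2.2 x)⟩

/-- An invertible context preserves purity. -/
lemma isPure_context {A B A' B' : C} {F : (A ⟶ B) → (A' ⟶ B')} {G : (A' ⟶ B') → (A ⟶ B)}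
    (hF : T.IsContext F) (hG : T.IsContext G) (hFG : ∀ g, F (G g) = g) (hGF : ∀ f, G (F f) = f)
    {f : A ⟶ B} (hf : T.IsPure f) : T.IsPure (F f) := by
  intro X Y c f' π h x hx
  obtain ⟨p, hp, hp1, hpf⟩ := hf _ _ _ _ _ (isCoarseGraining_context hG h) x (by rw [hx, hGF])
  refine ⟨p, hp, hp1, fun y hy => ?_⟩
  simpa only [hFG] using hF.2.vec_smul (hpf y hy)

lemma isPure_comp_isReversible {A B B' : C} {f : A ⟶ B} {k : B ⟶ B'} (hf : T.IsPure f)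
    (hk : T.IsReversible k) : T.IsPure (f ≫ k) := by
  obtain ⟨hk, l, hl, h1, h2⟩ := hk
  exact isPure_context (T.isContext_comp_right hk) (T.isContext_comp_right hl)
    (by simp [h2]) (by simp [h1]) hf

lemma isReversible_of_iso {A B : C} (e : A ≅ B) (h : T.IsChannel e.hom) (h' : T.IsChannel e.inv) :
    T.IsReversible e.hom := ⟨h, e.inv, h', by simp, by simp⟩

variable (T)

lemma isReversible_swap (A B : C) : T.IsReversible (β_ A B).hom :=
  ⟨T.isChannel_swap A B, (β_ B A).hom, T.isChannel_swap B A, by simp, by simp⟩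

lemma isReversible_assoc (A B D : C) : T.IsReversible (α_ A B D).hom :=
  isReversible_of_iso _ (T.isChannel_assoc A B D) (T.isChannel_assoc_inv A B D)

lemma isReversible_left (A : C) : T.IsReversible (λ_ A).hom :=
  isReversible_of_iso _ (T.isChannel_left A) (T.isChannel_left_inv A)

lemma isReversible_left_inv (A : C) : T.IsReversible (λ_ A).inv :=
  isReversible_of_iso (λ_ A).symm (T.isChannel_left_inv A) (T.isChannel_left A)

lemma isReversible_right (A : C) : T.IsReversible (ρ_ A).hom :=
  isReversible_of_iso _ (T.isChannel_right A) (T.isChannel_right_inv A)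

lemma isReversible_right_inv (A : C) : T.IsReversible (ρ_ A).inv :=
  isReversible_of_iso (ρ_ A).symm (T.isChannel_right_inv A) (T.isChannel_right A)

variable {T} in
lemma isChannel_comp {A B D : C} {f : A ⟶ B} {g : B ⟶ D} (hf : T.IsChannel f)
    (hg : T.IsChannel g) : T.IsChannel (f ≫ g) := (T.isContext_comp_right hg).1 _ hf

lemma vec_comp_scale {A B : C} (f : A ⟶ B) (s : 𝟙_ C ⟶ 𝟙_ C) :
    T.vec (f ≫ scale s B) = T.prob s • T.vec f := by
  funext S σ e
  have : σ ≫ f ▷ S ≫ scale s (B ⊗ S) ≫ e = s ≫ σ ≫ f ▷ S ≫ e := by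
    rw [← Category.assoc, ← Category.assoc _ (scale _ _), comp_scale]; simp
  simp only [vec, comp_whiskerRight, Category.assoc, scale_whiskerRight, this, T.prob_comp,
    Pi.smul_apply, smul_eq_mul]

/-- The scalar with a given probability. -/
noncomputable def scalar (r : Set.Icc (0 : ℝ) 1) : 𝟙_ C ⟶ 𝟙_ C := (T.exists_prob_eq r r.2).choose

@[simp] lemma prob_scalar (r : Set.Icc (0 : ℝ) 1) : T.prob (T.scalar r) = r :=
  (T.exists_prob_eq r r.2).choose_spec

lemma isTest_scale {X : Type} [Fintype X] (s : X → (𝟙_ C ⟶ 𝟙_ C)) (h : ∑ x, T.prob (s x) = 1)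
    (A : C) : T.IsTest (fun x => scale (s x) A) :=
  ((T.isContext_comp (T.isChannel_left_inv A) (T.isChannel_left A)).comp
    (T.isContext_whiskerRight _ _ A)).1 _ ((T.isTest_scalar_iff s).2 h)

open Classical in
/-- The outcomes of a nonempty test can be sorted in two classes, even if one of them is empty.
Outcomes of probability zero are added to both classes in order to make the sorting surjective. -/
lemma exists_bool_test {A B : C} {X : Type} [Fintype X] [Nonempty X] {f : X → (A ⟶ B)}
    (hf : T.IsTest f) (π : X → Bool) :
    ∃ c : Bool → (A ⟶ B), T.IsTest c ∧ ∀ b, T.vec (c b) = ∑ x with π x = b, T.vec (f x) := by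
  let s : Option Bool → (𝟙_ C ⟶ 𝟙_ C) := fun w =>
    w.elim (T.scalar ⟨1, by simp⟩) (fun _ => T.scalar ⟨0, by simp⟩)
  have hs : T.IsTest (fun w => scale (s w) B) := T.isTest_scale s (by simp [s]) B
  have h := T.isTest_comp _ _ hf hs
  obtain ⟨c, hc⟩ := T.exists_coarseGraining _
    (fun z : X × Option Bool => z.2.elim (π z.1) id) h
    (fun b => ⟨(Classical.arbitrary X, some b), rfl⟩)
  rw [isCoarseGraining_iff] at hc
  refine ⟨c, hc.1, fun b => ?_⟩
  rw [hc.2.2.2 b, Finset.sum_filter, Fintype.sum_prod_type, Finset.sum_filter]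
  refine Finset.sum_congr rfl fun x _ => ?_
  simp [Fintype.sum_option, vec_comp_scale, s]

end OperationalTheory

end OPT

/-! ### Norms, mixtures, and normalisation of states -/

namespace OPT

namespace CausalTheory

variable {C : Type u} [Category.{v} C] [MonoidalCategory C] [SymmetricCategory C]
  (T : CausalTheory C)

open CircuitData OperationalTheory

lemma pair_nonneg {A : C} (a : A ⟶ 𝟙_ C) (ρ : 𝟙_ C ⟶ A) : 0 ≤ T.pair a ρ := T.prob_nonneg _

lemma pair_le_one {A : C} (a : A ⟶ 𝟙_ C) (ρ : 𝟙_ C ⟶ A) : T.pair a ρ ≤ 1 := T.prob_le_one _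

lemma pair_comp {A B : C} (f : A ⟶ B) (a : B ⟶ 𝟙_ C) (ρ : 𝟙_ C ⟶ A) :
    T.pair (f ≫ a) ρ = T.pair a (ρ ≫ f) := by simp [pair]

lemma pair_scale_state {A : C} (a : A ⟶ 𝟙_ C) (s : 𝟙_ C ⟶ 𝟙_ C) (ρ : 𝟙_ C ⟶ A) :
    T.pair a (s ≫ ρ) = T.prob s * T.pair a ρ := by simp [pair, T.prob_comp]

lemma pair_scale_effect {A : C} (a : A ⟶ 𝟙_ C) (s : 𝟙_ C ⟶ 𝟙_ C) (ρ : 𝟙_ C ⟶ A) :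
    T.pair (a ≫ s) ρ = T.prob s * T.pair a ρ := by
  rw [mul_comm]; simp [pair, ← T.prob_comp]

lemma stateVec_scale {A : C} (s : 𝟙_ C ⟶ 𝟙_ C) (ρ : 𝟙_ C ⟶ A) :
    T.stateVec (s ≫ ρ) = T.prob s • T.stateVec ρ := by
  funext a; simp [stateVec, pair_scale_state]

lemma unit_comp {A B : C} {f : A ⟶ B} (hf : T.IsChannel f) : f ≫ T.unit B = T.unit A :=
  T.eq_unit _ (isChannel_comp hf (T.isChannel_unit B))

lemma unit_unit : T.unit (𝟙_ C) = 𝟙 (𝟙_ C) := (T.eq_unit _ (T.isChannel_id _)).symm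

lemma sum_effectVec_of_nonempty {A : C} {X : Type} [Fintype X] [Nonempty X]
    {f : X → (A ⟶ 𝟙_ C)} (hf : T.IsTest f) :
    ∑ x, T.effectVec (f x) = T.effectVec (T.unit A) := by
  classical
  obtain ⟨c, hc⟩ := T.exists_coarseGraining f (fun _ => ()) hf
    (fun _ => ⟨Classical.arbitrary X, rfl⟩)
  rw [isCoarseGraining_iff] at hc
  have h1 : c () = T.unit A := T.eq_unit _ hc.1
  have h2 := hc.2.2.2 ()
  rw [h1, T.vec_effect_sum_one] at h2
  simpa using h2.symm

lemma pair_le_unit {A : C} (a : A ⟶ 𝟙_ C) (ρ : 𝟙_ C ⟶ A) : T.pair a ρ ≤ T.pair (T.unit A) ρ := by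
  obtain ⟨X, f, x, hf, rfl⟩ := T.exists_isTest a
  have := T.finite_of_isTest f hf
  have := Fintype.ofFinite X
  have : Nonempty X := ⟨x⟩
  have h := congrFun (T.sum_effectVec_of_nonempty hf) ρ
  rw [Finset.sum_apply] at h
  have h2 := Finset.single_le_sum (f := fun y => T.effectVec (f y) ρ)
    (fun y _ => T.pair_nonneg _ _) (Finset.mem_univ x)
  exact h2.trans_eq h

lemma stateVec_eq_zero_of_unit {A : C} {ρ : 𝟙_ C ⟶ A} (h : T.pair (T.unit A) ρ = 0) :
    T.stateVec ρ = 0 := by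
  funext a
  exact le_antisymm ((T.pair_le_unit a ρ).trans_eq h) (T.pair_nonneg _ _)

lemma sum_pair_unit {A : C} {X : Type} [Fintype X] {f : X → (𝟙_ C ⟶ A)} (hf : T.IsTest f) :
    ∑ x, T.pair (T.unit A) (f x) = 1 :=
  (T.isTest_scalar_iff _).1 ((T.isContext_comp_right (T.isChannel_unit A)).1 _ hf)

lemma pair_unit_of_isChannel {A : C} {ρ : 𝟙_ C ⟶ A} (h : T.IsChannel ρ) :
    T.pair (T.unit A) ρ = 1 := by
  simpa using T.sum_pair_unit h

lemma isChannel_of_pair_unit {A : C} {ρ : 𝟙_ C ⟶ A} (h : T.pair (T.unit A) ρ = 1) :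
    T.IsChannel ρ := by
  classical
  obtain ⟨X, f, x, hf, rfl⟩ := T.exists_isTest ρ
  have := T.finite_of_isTest f hf
  have := Fintype.ofFinite X
  have hsum := T.sum_pair_unit hf
  have hz : ∀ y ≠ x, T.stateVec (f y) = 0 := by
    intro y hy
    refine T.stateVec_eq_zero_of_unit ?_
    rw [← Finset.add_sum_erase _ _ (Finset.mem_univ x), h] at hsum
    exact (Finset.sum_eq_zero_iff_of_nonneg (fun y _ => T.pair_nonneg _ _)).1
      (by linarith) y (by simp [hy])
  obtain ⟨c, hc⟩ := T.exists_coarseGraining f (fun _ => ()) hf (fun _ => ⟨x, rfl⟩)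
  rw [isCoarseGraining_iff] at hc
  have h2 := hc.2.2.2 ()
  rw [T.vec_state_sum_one] at h2
  have : c () = f x := by
    apply T.eq_of_stateVec
    rw [h2]
    simp only [Finset.filter_true]
    exact Finset.sum_eq_single_of_mem x (Finset.mem_univ _) fun y _ hy => hz y hy
  rw [← this]
  exact hc.1

lemma isChannel_state_iff {A : C} {ρ : 𝟙_ C ⟶ A} :
    T.IsChannel ρ ↔ T.pair (T.unit A) ρ = 1 :=
  ⟨T.pair_unit_of_isChannel, T.isChannel_of_pair_unit⟩

lemma stateNorm_eq {A : C} (ρ : 𝟙_ C ⟶ A) : T.stateNorm ρ = T.pair (T.unit A) ρ := by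
  have : Nonempty (A ⟶ 𝟙_ C) := ⟨T.unit A⟩
  refine le_antisymm (ciSup_le fun a => T.pair_le_unit a ρ) ?_
  exact le_ciSup (f := fun a => T.pair a ρ) ⟨1, by rintro _ ⟨a, rfl⟩; exact T.pair_le_one _ _⟩ _

lemma stateNorm_eq_one_iff {A : C} {ρ : 𝟙_ C ⟶ A} : T.stateNorm ρ = 1 ↔ T.IsChannel ρ := by
  rw [stateNorm_eq, isChannel_state_iff]

lemma isChannel_of_pair_eq_one {A : C} {a : A ⟶ 𝟙_ C} {ρ : 𝟙_ C ⟶ A} (h : T.pair a ρ = 1) :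
    T.IsChannel ρ :=
  T.isChannel_of_pair_unit (le_antisymm (T.pair_le_one _ _) (h ▸ T.pair_le_unit a ρ))

/-- A mixture of two normalised states, as the coarse-graining of the randomised preparation. -/
lemma exists_mixture {A : C} {ρ σ : 𝟙_ C ⟶ A} (hρ : T.IsChannel ρ) (hσ : T.IsChannel σ) {p : ℝ}
    (hp : p ∈ Set.Icc (0 : ℝ) 1) :
    ∃ ω : 𝟙_ C ⟶ A, T.IsChannel ω ∧ T.stateVec ω = p • T.stateVec ρ + (1 - p) • T.stateVec σ ∧
      ∃ f : Bool → (𝟙_ C ⟶ A), T.stateVec (f true) = p • T.stateVec ρ ∧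
        T.stateVec (f false) = (1 - p) • T.stateVec σ ∧
        T.IsCoarseGraining (fun _ : Unit => ω) f (fun _ => ()) := by
  classical
  have hp' : 1 - p ∈ Set.Icc (0 : ℝ) 1 := ⟨by linarith [hp.2], by linarith [hp.1]⟩
  let s : Bool → (𝟙_ C ⟶ 𝟙_ C) := fun b => cond b (T.scalar ⟨p, hp⟩) (T.scalar ⟨1 - p, hp'⟩)
  have hs : T.IsTest s := (T.isTest_scalar_iff s).2 (by simp [s])
  have hf := T.isTest_conditional s (fun b (_ : Unit) => cond b ρ σ) hs
    (by rintro (_ | _) <;> assumption)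
  have hf' := T.isTest_comp_equiv hf (Equiv.sigmaPUnit Bool).symm
  obtain ⟨c, hc⟩ := T.exists_coarseGraining _ (fun _ => ()) hf' (fun _ => ⟨true, rfl⟩)
  refine ⟨c (), hc.1, ?_, _, ?_, ?_, hc⟩
  · rw [isCoarseGraining_iff] at hc
    have h2 := hc.2.2.2 ()
    rw [T.vec_state_sum_one] at h2
    rw [h2]
    simp [s, stateVec_scale]
  · simp [s, stateVec_scale]
  · simp [s, stateVec_scale]

lemma isTest_bind {A B D : C} {X Y : Type} {f : X → (A ⟶ B)} {g : X → Y → (B ⟶ D)}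
    (hf : T.IsTest f) (hg : ∀ x, T.IsTest (g x)) :
    T.IsTest (fun z : X × Y => f z.1 ≫ g z.1 z.2) :=
  T.isTest_comp_equiv (T.isTest_conditional f g hf hg) (Equiv.sigmaEquivProd X Y).symm

/-- A nonzero state can be normalised: preparing it repeatedly until the preparation succeeds
gives states that converge to the normalised state, and the set of states is closed. -/
lemma exists_normalisation {A : C} (σ : 𝟙_ C ⟶ A) (h : T.pair (T.unit A) σ ≠ 0) :
    ∃ ρ : 𝟙_ C ⟶ A, T.IsChannel ρ ∧ T.stateVec σ = T.pair (T.unit A) σ • T.stateVec ρ := by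
  classical
  set l := T.pair (T.unit A) σ with hl
  have hl0 : 0 < l := lt_of_le_of_ne (T.pair_nonneg _ _) (Ne.symm h)
  have hl1 : l ≤ 1 := T.pair_le_one _ _
  obtain ⟨X, f, x₀, hf, hx₀⟩ := T.exists_isTest σ
  have := T.finite_of_isTest f hf
  have := Fintype.ofFinite X
  have key : ∀ n : ℕ, ∃ τ : 𝟙_ C ⟶ A,
      T.stateVec τ = (∑ k ∈ Finset.range n, (1 - l) ^ k) • T.stateVec σ := by
    intro n
    induction n with
    | zero => exact ⟨T.scalar ⟨0, by simp⟩ ≫ σ, by simp [stateVec_scale]⟩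
    | succ n ih =>
      obtain ⟨τ, hτ⟩ := ih
      obtain ⟨Y, g, y₀, hg, hy₀⟩ := T.exists_isTest τ
      have := T.finite_of_isTest g hg
      have := Fintype.ofFinite Y
      -- If `σ` has been prepared it is kept, otherwise the outcome is discarded and `τ` is tried.
      let s : Y → (𝟙_ C ⟶ 𝟙_ C) := fun y =>
        if y = y₀ then T.scalar ⟨1, by simp⟩ else T.scalar ⟨0, by simp⟩
      let k : X → Y → (A ⟶ A) := fun x y =>
        if x = x₀ then scale (s y) A else T.unit A ≫ g y
      have hk : ∀ x, T.IsTest (k x) := by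
        intro x
        by_cases hx : x = x₀
        · simp only [k, hx, if_true]
          exact T.isTest_scale s (by simp [s, apply_ite T.prob]) A
        · simp only [k, hx, if_false]
          exact (T.isContext_comp_left (T.isChannel_unit A)).1 _ hg
      have : Nonempty (X × Y) := ⟨(x₀, y₀)⟩
      obtain ⟨c, -, hc⟩ := T.exists_bool_test (T.isTest_bind hf hk) (fun z => decide (z.2 = y₀))
      have hc1 := hc true
      rw [T.vec_state_sum_one] at hc1
      have hterm : ∀ x, T.stateVec (f x ≫ k x y₀) =
          if x = x₀ then T.stateVec σ else T.pair (T.unit A) (f x) • T.stateVec τ := by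
        intro x
        by_cases hx : x = x₀
        · subst hx
          simp [k, s, comp_scale, stateVec_scale, hx₀]
        · simp only [k, hx, if_false]
          rw [← Category.assoc, stateVec_scale, hy₀]; rfl
      have hsum := T.sum_pair_unit hf
      rw [← Finset.add_sum_erase _ _ (Finset.mem_univ x₀), hx₀, ← hl] at hsum
      refine ⟨c true, ?_⟩
      rw [hc1, Finset.sum_filter, Fintype.sum_prod_type]
      simp only [decide_eq_true_eq, Finset.sum_ite_eq', Finset.mem_univ, if_true, hterm]
      rw [← Finset.add_sum_erase _ _ (Finset.mem_univ x₀), if_pos rfl,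
        Finset.sum_congr rfl fun x hx => if_neg (Finset.ne_of_mem_erase hx), ← Finset.sum_smul,
        eq_sub_of_add_eq' hsum, hτ, smul_smul, Finset.sum_range_succ']
      simp only [pow_succ', pow_zero, ← Finset.mul_sum]
      rw [add_comm, add_smul, one_smul]
  choose τ hτ using key
  have hlim : Filter.Tendsto (fun n => T.stateVec (τ n)) Filter.atTop
      (nhds (l⁻¹ • T.stateVec σ)) := by
    have := (hasSum_geometric_of_lt_one (r := 1 - l) (by linarith) (by linarith)).tendsto_sum_nat
    rw [sub_sub_cancel] at this
    simp only [hτ]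
    exact this.smul_const _
  obtain ⟨ρ, hρ⟩ := (T.isClosed_states A).mem_of_tendsto hlim
    (Filter.Eventually.of_forall fun n => ⟨τ n, rfl⟩)
  refine ⟨ρ, T.isChannel_of_pair_unit ?_, ?_⟩
  · have := congrFun hρ (T.unit A)
    change T.pair _ _ = l⁻¹ * T.pair _ _ at this
    rw [this, ← hl, inv_mul_cancel₀ h]
  · simp only [hρ, smul_smul, mul_inv_cancel₀ h, one_smul]

end CausalTheory

end OPT

/-! ### Pure states as extreme points, and purity of the identity -/

namespace OPT

namespace CausalTheory

variable {C : Type u} [Category.{v} C] [MonoidalCategory C] [SymmetricCategory C]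
  (T : CausalTheory C)

open CircuitData OperationalTheory

/-- The convex set of the vectors of normalised states. -/
def normStates (A : C) : Set ((A ⟶ 𝟙_ C) → ℝ) := T.stateVec '' {ρ | T.IsChannel ρ}

lemma stateVec_mem_normStates {A : C} {ρ : 𝟙_ C ⟶ A} :
    T.stateVec ρ ∈ T.normStates A ↔ T.IsChannel ρ := by
  refine ⟨fun ⟨σ, hσ, h⟩ => ?_, fun h => ⟨ρ, h, rfl⟩⟩
  rwa [← T.eq_of_stateVec h]

lemma isCompact_normStates (A : C) : IsCompact (T.normStates A) := by
  have h1 : T.normStates A = Set.range (fun ρ : 𝟙_ C ⟶ A => T.stateVec ρ) ∩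
      {f | f (T.unit A) = 1} := by
    ext f
    constructor
    · rintro ⟨ρ, hρ, rfl⟩
      exact ⟨⟨ρ, rfl⟩, T.pair_unit_of_isChannel hρ⟩
    · rintro ⟨⟨ρ, rfl⟩, h⟩
      exact ⟨ρ, T.isChannel_of_pair_unit h, rfl⟩
  refine IsCompact.of_isClosed_subset (isCompact_univ_pi fun _ => isCompact_Icc (a := (0 : ℝ))
    (b := 1)) ?_ ?_
  · rw [h1]
    exact (T.isClosed_states A).inter
      (isClosed_eq (continuous_apply (T.unit A)) continuous_const)
  · rintro _ ⟨ρ, -, rfl⟩ a -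
    exact ⟨T.pair_nonneg _ _, T.pair_le_one _ _⟩

lemma convex_normStates (A : C) : Convex ℝ (T.normStates A) := by
  rintro _ ⟨ρ, hρ, rfl⟩ _ ⟨σ, hσ, rfl⟩ a b ha hb hab
  obtain ⟨ω, hω, h, -⟩ := T.exists_mixture hρ hσ (p := a) ⟨ha, by linarith⟩
  exact ⟨ω, hω, by rw [h, ← hab]; simp⟩

lemma extreme_of_isPure {A : C} {α : 𝟙_ C ⟶ A} (hα : T.IsPure α) (hα1 : T.IsChannel α) :
    T.stateVec α ∈ (T.normStates A).extremePoints ℝ := by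
  rw [mem_extremePoints_iff_left]
  refine ⟨⟨α, hα1, rfl⟩, ?_⟩
  rintro _ ⟨ρ, hρ, rfl⟩ _ ⟨σ, hσ, rfl⟩ ⟨a, b, ha, hb, hab, h⟩
  obtain ⟨ω, hω, h', f, hf, -, hc⟩ := T.exists_mixture hρ hσ (p := a) ⟨ha.le, by linarith⟩
  have hωα : ω = α := by
    apply T.eq_of_stateVec
    rw [h', ← h, ← hab]; simp
  subst hωα
  obtain ⟨p, -, -, hp⟩ := hα _ _ _ _ _ hc () rfl
  have h1 := (T.vec_state_smul).1 (hp true rfl)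
  rw [hf] at h1
  have h2 := congrFun h1 (T.unit A)
  change a * T.pair _ _ = p true * T.pair _ _ at h2
  rw [T.pair_unit_of_isChannel hρ, T.pair_unit_of_isChannel hω, mul_one, mul_one] at h2
  rw [← h2] at h1
  exact smul_right_injective _ ha.ne' h1

/-- Normalising the terms of a refinement turns it into a convex decomposition of the state. -/
lemma isPure_of_extreme {A : C} {α : 𝟙_ C ⟶ A}
    (hα : T.stateVec α ∈ (T.normStates A).extremePoints ℝ) : T.IsPure α := by
  classical
  rw [mem_extremePoints_iff_left] at hα
  have hα1 : T.IsChannel α := T.stateVec_mem_normStates.1 hα.1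
  intro X Y c f π h x hx
  have := T.finite_of_isTest f h.2.1
  have := Fintype.ofFinite Y
  rw [isCoarseGraining_iff] at h
  have hsum := h.2.2.2 x
  rw [hx, T.vec_state_sum_one] at hsum
  have hnorm : ∀ y, ∃ ρ : 𝟙_ C ⟶ A, T.IsChannel ρ ∧
      T.stateVec (f y) = T.pair (T.unit A) (f y) • T.stateVec ρ := by
    intro y
    by_cases hy : T.pair (T.unit A) (f y) = 0
    · exact ⟨α, hα1, by rw [hy, zero_smul, T.stateVec_eq_zero_of_unit hy]⟩
    · exact T.exists_normalisation _ hy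
  choose ρ hρ1 hρ using hnorm
  have hp : ∑ y with π y = x, T.pair (T.unit A) (f y) = 1 := by
    have := congrFun hsum (T.unit A)
    rw [Finset.sum_apply] at this
    exact this.symm.trans (T.pair_unit_of_isChannel hα1)
  refine ⟨fun y => T.pair (T.unit A) (f y), fun y _ => T.pair_nonneg _ _, ?_, fun y hy => ?_⟩
  · rw [← hp, ← finsum_mem_coe_finset]
    congr 1; ext y; simp
  · rw [T.vec_state_smul]
    beta_reduce
    have hy' : y ∈ ({z | π z = x} : Finset Y) := by simpa using hy
    by_cases h0 : T.pair (T.unit A) (f y) = 0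
    · rw [T.stateVec_eq_zero_of_unit h0, h0, zero_smul]
    rw [← Finset.add_sum_erase _ _ hy'] at hp hsum
    have h0' : 0 < T.pair (T.unit A) (f y) := lt_of_le_of_ne (T.pair_nonneg _ _) (Ne.symm h0)
    by_cases h1 : T.pair (T.unit A) (f y) = 1
    · rw [h1, one_smul, hsum, Finset.sum_eq_zero, add_zero]
      intro z hz
      refine T.stateVec_eq_zero_of_unit ?_
      exact (Finset.sum_eq_zero_iff_of_nonneg (fun y _ => T.pair_nonneg _ _)).1
        (by linarith) z hz
    · have h1' : T.pair (T.unit A) (f y) < 1 := lt_of_le_of_ne (T.pair_le_one _ _) h1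
      set s := ({z | π z = x} : Finset Y).erase y
      have hpos : 0 < ∑ z ∈ s, T.pair (T.unit A) (f z) := by linarith
      have hτ := (T.convex_normStates A).centerMass_mem (t := s)
        (w := fun z => T.pair (T.unit A) (f z)) (z := fun z => T.stateVec (ρ z))
        (fun z _ => T.pair_nonneg _ _) hpos (fun z _ => ⟨ρ z, hρ1 z, rfl⟩)
      rw [hρ y]
      congr 1
      refine hα.2 _ ⟨ρ y, hρ1 y, rfl⟩ _ hτ ⟨_, _, h0', hpos, hp, ?_⟩
      rw [Finset.centerMass, smul_smul, mul_inv_cancel₀ hpos.ne', one_smul, ← hρ y, hsum]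
      simp only [← hρ]

variable {T} (hT : T.IsSharpWithPurification)
include hT

lemma exists_isChannel_state (A : C) : ∃ ρ : 𝟙_ C ⟶ A, T.IsChannel ρ := by
  obtain ⟨a, -, ρ, h⟩ := hT.pure_sharpness A
  exact ⟨ρ, T.isChannel_of_pair_eq_one h⟩

lemma exists_isPure_state (A : C) : ∃ α : 𝟙_ C ⟶ A, T.IsPure α ∧ T.IsChannel α := by
  obtain ⟨ρ, hρ⟩ := exists_isChannel_state hT A
  obtain ⟨x, hx⟩ := (T.isCompact_normStates A).extremePoints_nonempty ⟨_, ρ, hρ, rfl⟩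
  obtain ⟨α, hα, rfl⟩ := extremePoints_subset hx
  exact ⟨α, T.isPure_of_extreme hx, hα⟩

omit hT in
/-- The pure states of a system separate its effects, by the Krein–Milman theorem. -/
lemma effect_ext_of_isPure {A : C} {a b : A ⟶ 𝟙_ C}
    (h : ∀ α : 𝟙_ C ⟶ A, T.IsPure α → T.IsChannel α → T.pair a α = T.pair b α) : a = b := by
  apply T.eq_of_effectVec
  funext σ
  by_cases h0 : T.pair (T.unit A) σ = 0
  · have := T.stateVec_eq_zero_of_unit h0
    exact (congrFun this a).trans (congrFun this b).symm
  obtain ⟨ρ, hρ1, hρ⟩ := T.exists_normalisation σ h0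
  have hclosed : IsClosed {f : (A ⟶ 𝟙_ C) → ℝ | f a = f b} :=
    isClosed_eq (continuous_apply a) (continuous_apply b)
  have hconv : Convex ℝ {f : (A ⟶ 𝟙_ C) → ℝ | f a = f b} := by
    intro f hf g hg s t _ _ _
    simp only [Set.mem_ofPred_eq, Pi.add_apply, Pi.smul_apply] at *
    rw [hf, hg]
  have hsub : T.normStates A ⊆ {f | f a = f b} := by
    rw [← closure_convexHull_extremePoints (T.isCompact_normStates A) (T.convex_normStates A)]
    refine closure_minimal (convexHull_min ?_ hconv) hclosed
    intro x hx
    obtain ⟨α, hα, rfl⟩ := extremePoints_subset hx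
    exact h α (T.isPure_of_extreme hx) hα
  have : T.stateVec ρ a = T.stateVec ρ b := hsub ⟨ρ, hρ1, rfl⟩
  change T.stateVec σ a = T.stateVec σ b
  rw [hρ, Pi.smul_apply, Pi.smul_apply, this]

omit hT in
lemma isChannel_whiskerRight {A B : C} {f : A ⟶ B} (hf : T.IsChannel f) (S : C) :
    T.IsChannel (f ▷ S) := (T.isContext_whiskerRight A B S).1 _ hf

omit hT in
lemma isChannel_whiskerLeft {A B : C} {f : A ⟶ B} (hf : T.IsChannel f) (S : C) :
    T.IsChannel (S ◁ f) := (T.isContext_whiskerLeft A B S).1 _ hf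

omit hT in
lemma isChannel_marginal {A B : C} {Ψ : 𝟙_ C ⟶ A ⊗ B} (h : T.IsChannel Ψ) :
    T.IsChannel (T.marginal Ψ) :=
  isChannel_comp h (isChannel_comp (isChannel_whiskerLeft (T.isChannel_unit B) A)
    (T.isChannel_right A))

omit hT in
lemma marginal_comp_whiskerRight {A A' B : C} (Ψ : 𝟙_ C ⟶ A ⊗ B) (f : A ⟶ A') :
    T.marginal (Ψ ≫ f ▷ B) = T.marginal Ψ ≫ f := by
  simp [marginal, ← whisker_exchange_assoc]

/-- A transformation that multiplies every normalised pure state, also next to an ancilla, by a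
number that may depend on the state is a multiple of the identity. -/
lemma eq_smul_id_of_forall {A : C} (f : A ⟶ A)
    (h : ∀ (S : C) (Ψ : 𝟙_ C ⟶ A ⊗ S), T.IsPure Ψ → T.IsChannel Ψ →
      ∃ p : ℝ, T.stateVec (Ψ ≫ f ▷ S) = p • T.stateVec Ψ) :
    ∃ p : ℝ, T.vec f = p • T.vec (𝟙 A) := by
  -- the number for `Ψ` is the probability of `f` on the marginal state
  have h1 : ∀ (S : C) (Ψ : 𝟙_ C ⟶ A ⊗ S), T.IsPure Ψ → T.IsChannel Ψ →
      T.stateVec (Ψ ≫ f ▷ S) = T.pair (f ≫ T.unit A) (T.marginal Ψ) • T.stateVec Ψ := by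
    intro S Ψ hΨ hΨ1
    obtain ⟨p, hp⟩ := h S Ψ hΨ hΨ1
    have := congrFun hp (A ◁ T.unit S ≫ (ρ_ A).hom ≫ T.unit A)
    have e1 : T.stateVec (Ψ ≫ f ▷ S) (A ◁ T.unit S ≫ (ρ_ A).hom ≫ T.unit A) =
        T.pair (f ≫ T.unit A) (T.marginal Ψ) := by
      rw [pair_comp, ← marginal_comp_whiskerRight]; simp [stateVec, marginal, pair]
    have e2 : T.stateVec Ψ (A ◁ T.unit S ≫ (ρ_ A).hom ≫ T.unit A) = 1 := by
      rw [← T.pair_unit_of_isChannel (isChannel_marginal hΨ1)]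
      simp [stateVec, marginal, pair]
    rw [e1, Pi.smul_apply, e2, smul_eq_mul, mul_one] at this
    rw [hp, this]
  have h2 : ∀ ρ : 𝟙_ C ⟶ A, T.IsChannel ρ →
      T.stateVec (ρ ≫ f) = T.pair (f ≫ T.unit A) ρ • T.stateVec ρ := by
    intro ρ hρ
    obtain ⟨S, Ψ, hΨ, hΨ1, rfl⟩ := hT.exists_purification ρ (T.stateNorm_eq_one_iff.2 hρ)
    rw [T.stateNorm_eq_one_iff] at hΨ1
    rw [← marginal_comp_whiskerRight]
    funext a
    have := congrFun (h1 S Ψ hΨ hΨ1) (A ◁ T.unit S ≫ (ρ_ A).hom ≫ a)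
    simpa [stateVec, marginal, pair] using this
  -- by linearity this probability does not depend on the state
  have h3 : ∀ ρ σ : 𝟙_ C ⟶ A, T.IsChannel ρ → T.IsChannel σ →
      T.pair (f ≫ T.unit A) ρ = T.pair (f ≫ T.unit A) σ := by
    intro ρ σ hρ hσ
    obtain ⟨ω, hω, hm, -⟩ := T.exists_mixture hρ hσ (p := 1 / 2) (by norm_num)
    by_contra hne
    apply hne
    have hρσ : ∀ a, T.pair a ρ = T.pair a σ := by
      intro a
      have k1 := congrFun (h2 ρ hρ) a
      have k2 := congrFun (h2 σ hσ) a
      have k3 := congrFun (h2 ω hω) a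
      have k4 := congrFun hm (f ≫ a)
      have k5 := congrFun hm (f ≫ T.unit A)
      have k6 := congrFun hm a
      simp only [stateVec, Pi.smul_apply, Pi.add_apply, smul_eq_mul, pair_comp]
        at k1 k2 k3 k4 k5 k6 hne
      have : (T.pair (T.unit A) (ρ ≫ f) - T.pair (T.unit A) (σ ≫ f)) *
          (T.pair a ρ - T.pair a σ) = 0 := by
        rw [k3, k5, k6, k1, k2] at k4
        linear_combination (-4) * k4
      rcases mul_eq_zero.1 this with h | h
      · exact absurd (sub_eq_zero.1 h) hne
      · exact sub_eq_zero.1 h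
    exact hρσ _
  obtain ⟨ρ₀, hρ₀⟩ := exists_isChannel_state hT A
  refine ⟨T.pair (f ≫ T.unit A) ρ₀, ?_⟩
  set p := T.pair (f ≫ T.unit A) ρ₀
  have h4 : ∀ (S : C) (σ : 𝟙_ C ⟶ A ⊗ S), T.IsChannel σ →
      T.stateVec (σ ≫ f ▷ S) = p • T.stateVec σ := by
    intro S σ hσ
    obtain ⟨F, Ψ, hΨ, hΨ1, rfl⟩ := hT.exists_purification σ (T.stateNorm_eq_one_iff.2 hσ)
    rw [T.stateNorm_eq_one_iff] at hΨ1
    have hΨ' := isPure_comp_isReversible hΨ (T.isReversible_assoc A S F)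
    have hΨ1' := isChannel_comp hΨ1 (T.isChannel_assoc A S F)
    have := h1 _ _ hΨ' hΨ1'
    rw [h3 _ ρ₀ (isChannel_marginal hΨ1') hρ₀] at this
    rw [← marginal_comp_whiskerRight]
    funext a
    have := congrFun this ((α_ A S F).inv ≫ (A ⊗ S) ◁ T.unit F ≫ (ρ_ (A ⊗ S)).hom ≫ a)
    simpa [stateVec, marginal, pair, p] using this
  funext S σ e
  by_cases h0 : T.pair (T.unit _) σ = 0
  · have := T.stateVec_eq_zero_of_unit h0
    exact (congrFun this (f ▷ S ≫ e)).trans (by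
      have := congrFun this e
      simp only [stateVec, pair] at this
      simp [vec, this])
  obtain ⟨ρ, hρ1, hρ⟩ := T.exists_normalisation σ h0
  have k1 := congrFun hρ (f ▷ S ≫ e)
  have k2 := congrFun hρ e
  have k3 := congrFun (h4 S ρ hρ1) e
  simp only [stateVec, pair, Pi.smul_apply, smul_eq_mul, Category.assoc] at k1 k2 k3
  simp only [vec, Pi.smul_apply, smul_eq_mul, id_whiskerRight, Category.id_comp, k1, k2, k3]
  ring

lemma isPure_id (A : C) : T.IsPure (𝟙 A) := by
  classical
  intro X Y c f π h x hx
  have hY := T.finite_of_isTest f h.2.1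
  have hY' := Fintype.ofFinite Y
  have key : ∀ y, π y = x → ∃ p : ℝ, T.vec (f y) = p • T.vec (𝟙 A) := by
    intro y hy
    refine eq_smul_id_of_forall hT (f y) fun S Ψ hΨ hΨ1 => ?_
    have hF := (T.isContext_comp_left hΨ1).comp (T.isContext_whiskerRight A A S)
    obtain ⟨p, -, -, hp⟩ := hΨ _ _ _ _ _ (isCoarseGraining_context hF h) x (by simp [hx])
    exact ⟨p y, T.vec_state_smul.1 (hp y hy)⟩
  choose! p hp using key
  rw [isCoarseGraining_iff] at h
  obtain ⟨ρ, hρ⟩ := exists_isChannel_state hT A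
  -- the numbers are probabilities, as one sees on a normalised state
  have hunit : ∀ y, π y = x → T.pair (T.unit A) (ρ ≫ f y) = p y := by
    intro y hy
    have := T.vec_state_smul.1 ((T.reindexes_comp_left ρ).vec_smul (hp y hy))
    have := congrFun this (T.unit A)
    simp only [stateVec, Category.comp_id, Pi.smul_apply, T.pair_unit_of_isChannel hρ] at this
    simpa using this
  refine ⟨p, fun y hy => ?_, ?_, hp⟩
  · rw [← hunit y hy]; exact T.pair_nonneg _ _
  · have hsum := h.2.2.2 x
    rw [hx] at hsum
    have := T.vec_state_sum_one.1 ((T.reindexes_comp_left ρ).vec_sum_one hsum)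
    have := congrFun this (T.unit A)
    rw [Finset.sum_apply] at this
    simp only [stateVec, Category.comp_id, T.pair_unit_of_isChannel hρ] at this
    rw [this, Finset.sum_congr rfl fun y hy => hunit y (by simpa using hy),
      ← finsum_mem_coe_finset]
    congr 1; ext y; simp

lemma isPure_of_isReversible {A B : C} {f : A ⟶ B} (hf : T.IsReversible f) : T.IsPure f := by
  simpa using isPure_comp_isReversible (isPure_id hT A) hf

lemma isPure_whiskerLeft {A B : C} (S : C) {f : A ⟶ B} (hf : T.IsPure f) : T.IsPure (S ◁ f) := by
  simpa using hT.pure_tensor _ _ (isPure_id hT S) hf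

lemma isPure_whiskerRight {A B : C} (S : C) {f : A ⟶ B} (hf : T.IsPure f) : T.IsPure (f ▷ S) := by
  simpa using hT.pure_tensor _ _ hf (isPure_id hT S)

end CausalTheory

end OPT

/-! ### Products, partial contractions, and uniqueness of purifications -/

namespace OPT

section Contract

variable {C : Type u} [Category.{v} C] [MonoidalCategory C]

/-- The unnormalised state of `B` that is left when the effect `a` occurs on the first half of a
state of `A ⊗ B`. -/
def contractLeft {A B : C} (a : A ⟶ 𝟙_ C) (Ψ : 𝟙_ C ⟶ A ⊗ B) : 𝟙_ C ⟶ B :=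
  Ψ ≫ a ▷ B ≫ (λ_ B).hom

/-- The unnormalised state of `A` that is left when the effect `b` occurs on the second half of a
state of `A ⊗ B`. -/
def contractRight {A B : C} (b : B ⟶ 𝟙_ C) (Ψ : 𝟙_ C ⟶ A ⊗ B) : 𝟙_ C ⟶ A :=
  Ψ ≫ A ◁ b ≫ (ρ_ A).hom

lemma contractLeft_comp_eq_contractRight_comp {A B : C} (a : A ⟶ 𝟙_ C) (b : B ⟶ 𝟙_ C)
    (Ψ : 𝟙_ C ⟶ A ⊗ B) : contractLeft a Ψ ≫ b = contractRight b Ψ ≫ a := by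
  simp only [contractLeft, contractRight, Category.assoc]
  rw [← leftUnitor_naturality, ← rightUnitor_naturality, ← whisker_exchange_assoc, unitors_equal]

lemma contractLeft_whiskerLeft {A B B' : C} (a : A ⟶ 𝟙_ C) (Ψ : 𝟙_ C ⟶ A ⊗ B) (f : B ⟶ B') :
    contractLeft a (Ψ ≫ A ◁ f) = contractLeft a Ψ ≫ f := by
  simp [contractLeft, whisker_exchange_assoc]

lemma contractRight_whiskerLeft {A B B' : C} (b : B' ⟶ 𝟙_ C) (Ψ : 𝟙_ C ⟶ A ⊗ B) (f : B ⟶ B') :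
    contractRight b (Ψ ≫ A ◁ f) = contractRight (f ≫ b) Ψ := by
  simp [contractRight]

/-- The product of the states `α` and `β`. -/
def prodState {A B : C} (α : 𝟙_ C ⟶ A) (β : 𝟙_ C ⟶ B) : 𝟙_ C ⟶ A ⊗ B :=
  α ≫ (ρ_ A).inv ≫ A ◁ β

lemma contractLeft_prodState {A B : C} (a : A ⟶ 𝟙_ C) (α : 𝟙_ C ⟶ A) (β : 𝟙_ C ⟶ B) :
    contractLeft a (prodState α β) = (α ≫ a) ≫ β := by
  simp only [contractLeft, prodState, Category.assoc]
  rw [whisker_exchange_assoc, leftUnitor_naturality, ← rightUnitor_inv_naturality_assoc]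
  simp [unitors_equal]

lemma contractRight_prodState {A B : C} (b : B ⟶ 𝟙_ C) (α : 𝟙_ C ⟶ A) (β : 𝟙_ C ⟶ B) :
    contractRight b (prodState α β) = (β ≫ b) ≫ α := by
  have h : A ◁ β ≫ A ◁ b = A ◁ (β ≫ b) := by simp
  simp only [contractRight, prodState, Category.assoc]
  rw [rightUnitor_inv_naturality_assoc, reassoc_of% h, ← whisker_exchange_assoc,
    rightUnitor_naturality, ← unitors_equal, leftUnitor_naturality_assoc, ← unitors_inv_equal]
  simp

lemma contractLeft_swap {A B : C} [BraidedCategory C] (b : B ⟶ 𝟙_ C) (Ψ : 𝟙_ C ⟶ A ⊗ B) :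
    contractLeft b (Ψ ≫ (β_ A B).hom) = contractRight b Ψ := by
  simp only [contractLeft, contractRight, Category.assoc]
  rw [← BraidedCategory.braiding_naturality_right_assoc, braiding_leftUnitor]

lemma contractRight_swap {A B : C} [BraidedCategory C] (a : A ⟶ 𝟙_ C) (Ψ : 𝟙_ C ⟶ A ⊗ B) :
    contractRight a (Ψ ≫ (β_ A B).hom) = contractLeft a Ψ := by
  simp only [contractLeft, contractRight, Category.assoc]
  rw [← BraidedCategory.braiding_naturality_left_assoc, braiding_rightUnitor]

end Contract

namespace CausalTheory

variable {C : Type u} [Category.{v} C] [MonoidalCategory C] [SymmetricCategory C]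
  {T : CausalTheory C}

open CircuitData OperationalTheory

lemma marginal_eq {A B : C} (Ψ : 𝟙_ C ⟶ A ⊗ B) :
    T.marginal Ψ = contractRight (T.unit B) Ψ := rfl

lemma pair_contract {A B : C} (a : A ⟶ 𝟙_ C) (b : B ⟶ 𝟙_ C) (Ψ : 𝟙_ C ⟶ A ⊗ B) :
    T.pair b (contractLeft a Ψ) = T.pair a (contractRight b Ψ) := by
  simp only [pair, contractLeft_comp_eq_contractRight_comp]

/-- States of the same norm are equal if one dominates the other on all effects: both have the same
sum of probabilities on every test. -/
lemma eq_of_pair_le {A : C} {σ τ : 𝟙_ C ⟶ A} (h : ∀ b, T.pair b σ ≤ T.pair b τ)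
    (hu : T.pair (T.unit A) σ = T.pair (T.unit A) τ) : σ = τ := by
  apply T.eq_of_stateVec
  funext b
  obtain ⟨X, f, x, hf, rfl⟩ := T.exists_isTest b
  have := T.finite_of_isTest f hf
  have := Fintype.ofFinite X
  have : Nonempty X := ⟨x⟩
  have hs := fun ρ => congrFun (T.sum_effectVec_of_nonempty hf) ρ
  simp only [Finset.sum_apply, effectVec] at hs
  exact (Finset.sum_eq_sum_iff_of_le (fun y _ => h (f y))).1
    (by rw [hs, hs, hu]) x (Finset.mem_univ x)

/-- An effect that is certain on a marginal acts on the joint state as the deterministic effect. -/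
lemma contractLeft_eq_unit {A B : C} {a : A ⟶ 𝟙_ C} {Ψ : 𝟙_ C ⟶ A ⊗ B} (hΨ : T.IsChannel Ψ)
    (h : T.pair a (T.marginal Ψ) = 1) : contractLeft a Ψ = contractLeft (T.unit A) Ψ := by
  refine eq_of_pair_le (T := T) (fun b => ?_) ?_
  · rw [pair_contract, pair_contract]; exact T.pair_le_unit _ _
  · rw [pair_contract, pair_contract]
    exact h.trans (T.pair_unit_of_isChannel (isChannel_marginal hΨ)).symm

lemma isChannel_contractLeft_unit {A B : C} {Ψ : 𝟙_ C ⟶ A ⊗ B} (hΨ : T.IsChannel Ψ) :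
    T.IsChannel (contractLeft (T.unit A) Ψ) :=
  isChannel_comp hΨ (isChannel_comp (isChannel_whiskerRight (T.isChannel_unit A) B)
    (T.isChannel_left B))

lemma isChannel_prodState {A B : C} {α : 𝟙_ C ⟶ A} {β : 𝟙_ C ⟶ B} (hα : T.IsChannel α)
    (hβ : T.IsChannel β) : T.IsChannel (prodState α β) :=
  isChannel_comp hα (isChannel_comp (T.isChannel_right_inv A) (isChannel_whiskerLeft hβ A))

lemma scalar_eq_id {s : 𝟙_ C ⟶ 𝟙_ C} (h : T.prob s = 1) : s = 𝟙 (𝟙_ C) :=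
  T.eq_of_prob (by rw [h, T.prob_id])

lemma comp_unit_state {A : C} {ρ : 𝟙_ C ⟶ A} (h : T.IsChannel ρ) : ρ ≫ T.unit A = 𝟙 (𝟙_ C) :=
  scalar_eq_id (T.pair_unit_of_isChannel h)

lemma isPurification_iff {A B : C} {Ψ : 𝟙_ C ⟶ A ⊗ B} {ρ : 𝟙_ C ⟶ A} :
    T.IsPurification Ψ ρ ↔ T.IsPure Ψ ∧ T.IsChannel Ψ ∧ T.marginal Ψ = ρ := by
  rw [IsPurification, stateNorm_eq_one_iff]

variable (hT : T.IsSharpWithPurification)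
include hT

lemma isPure_prodState {A B : C} {α : 𝟙_ C ⟶ A} {β : 𝟙_ C ⟶ B} (hα : T.IsPure α)
    (hβ : T.IsPure β) : T.IsPure (prodState α β) :=
  hT.pure_comp _ _ hα (hT.pure_comp _ _
    (isPure_of_isReversible hT (T.isReversible_right_inv A)) (isPure_whiskerLeft hT A hβ))

lemma isPure_contractLeft {A B : C} {a : A ⟶ 𝟙_ C} {Ψ : 𝟙_ C ⟶ A ⊗ B} (ha : T.IsPure a)
    (hΨ : T.IsPure Ψ) : T.IsPure (contractLeft a Ψ) :=
  hT.pure_comp _ _ hΨ (hT.pure_comp _ _ (isPure_whiskerRight hT B ha)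
    (isPure_of_isReversible hT (T.isReversible_left B)))

lemma isPure_contractRight {A B : C} {b : B ⟶ 𝟙_ C} {Ψ : 𝟙_ C ⟶ A ⊗ B} (hb : T.IsPure b)
    (hΨ : T.IsPure Ψ) : T.IsPure (contractRight b Ψ) :=
  hT.pure_comp _ _ hΨ (hT.pure_comp _ _ (isPure_whiskerLeft hT A hb)
    (isPure_of_isReversible hT (T.isReversible_right A)))

lemma exists_isPurification {A : C} {ρ : 𝟙_ C ⟶ A} (hρ : T.IsChannel ρ) :
    ∃ (B : C) (Ψ : 𝟙_ C ⟶ A ⊗ B), T.IsPure Ψ ∧ T.IsChannel Ψ ∧ T.marginal Ψ = ρ := by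
  obtain ⟨B, Ψ, h⟩ := hT.exists_purification ρ (T.stateNorm_eq_one_iff.2 hρ)
  exact ⟨B, Ψ, isPurification_iff.1 h⟩

/-- Reversible channels act transitively on the normalised pure states: these are purifications of
the state of the trivial system. -/
lemma exists_isReversible_of_isPure {A : C} {α β : 𝟙_ C ⟶ A} (hα : T.IsPure α)
    (hα1 : T.IsChannel α) (hβ : T.IsPure β) (hβ1 : T.IsChannel β) :
    ∃ U : A ⟶ A, T.IsReversible U ∧ α ≫ U = β := by
  have key : ∀ {γ : 𝟙_ C ⟶ A}, T.IsPure γ → T.IsChannel γ →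
      T.IsPurification (γ ≫ (λ_ A).inv) (𝟙 (𝟙_ C)) := by
    intro γ hγ hγ1
    have h1 := isChannel_comp hγ1 (T.isChannel_left_inv A)
    refine isPurification_iff.2
      ⟨isPure_comp_isReversible hγ (T.isReversible_left_inv A), h1, ?_⟩
    exact (T.eq_unit _ (isChannel_marginal h1)).trans T.unit_unit
  obtain ⟨U, hU, h⟩ := hT.purification_unique _ _ _ (key hα hα1) (key hβ hβ1)
  refine ⟨U, hU, ?_⟩
  rw [Category.assoc, ← leftUnitor_inv_naturality, ← Category.assoc] at h
  exact ((cancel_mono _).1 h).symm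

/-- A state on which a pure effect is certain is pure. -/
lemma isPure_of_pair_eq_one {A : C} {a : A ⟶ 𝟙_ C} {ρ : 𝟙_ C ⟶ A} (ha : T.IsPure a)
    (h : T.pair a ρ = 1) : T.IsPure ρ := by
  obtain ⟨B, Ψ, hΨ, hΨ1, rfl⟩ := exists_isPurification hT (T.isChannel_of_pair_eq_one h)
  -- The marginal on the purifying system is pure, so `Ψ` is a product state.
  have hβ := isPure_contractLeft hT ha hΨ
  rw [contractLeft_eq_unit hΨ1 h] at hβ
  have hβ1 := isChannel_contractLeft_unit hΨ1
  set β := contractLeft (T.unit A) Ψ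
  obtain ⟨α, hα, hα1⟩ := exists_isPure_state hT A
  obtain ⟨U, hU, hUΨ⟩ := hT.purification_unique β (prodState β α) (Ψ ≫ (β_ A B).hom)
    (isPurification_iff.2 ⟨isPure_prodState hT hβ hα, isChannel_prodState hβ1 hα1, by
      rw [marginal_eq, contractRight_prodState, comp_unit_state hα1, Category.id_comp]⟩)
    (isPurification_iff.2 ⟨isPure_comp_isReversible hΨ (T.isReversible_swap A B),
      isChannel_comp hΨ1 (T.isChannel_swap A B), by
      rw [marginal_eq, contractRight_swap]⟩)
  rw [marginal_eq, ← contractLeft_swap, hUΨ, contractLeft_whiskerLeft, contractLeft_prodState,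
    comp_unit_state hβ1, Category.id_comp]
  exact isPure_comp_isReversible hα hU

/-- A pure effect is certain on at most one state. -/
lemma eq_of_pair_eq_one {A : C} {a : A ⟶ 𝟙_ C} {ρ σ : 𝟙_ C ⟶ A} (ha : T.IsPure a)
    (hρ : T.pair a ρ = 1) (hσ : T.pair a σ = 1) : ρ = σ := by
  have hρ1 := T.isChannel_of_pair_eq_one hρ
  have hσ1 := T.isChannel_of_pair_eq_one hσ
  obtain ⟨ω, hω, hm, -⟩ := T.exists_mixture hρ1 hσ1 (p := 1 / 2) (by norm_num)
  have hωa : T.pair a ω = 1 := by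
    have := congrFun hm a
    simp only [stateVec, Pi.add_apply, Pi.smul_apply, smul_eq_mul, hρ, hσ] at this
    rw [this]; norm_num
  have hext := T.extreme_of_isPure (isPure_of_pair_eq_one hT ha hωa) hω
  rw [mem_extremePoints] at hext
  have := hext.2 _ ⟨ρ, hρ1, rfl⟩ _ ⟨σ, hσ1, rfl⟩
    ⟨1 / 2, 1 - 1 / 2, by norm_num, by norm_num, by norm_num, hm.symm⟩
  exact T.eq_of_stateVec (this.1.trans this.2.symm)

lemma exists_isPure_effect {A : C} {α : 𝟙_ C ⟶ A} (hα : T.IsPure α) (hα1 : T.IsChannel α) :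
    ∃ a : A ⟶ 𝟙_ C, T.IsPure a ∧ T.pair a α = 1 := by
  obtain ⟨a, ha, ρ, h⟩ := hT.pure_sharpness A
  obtain ⟨U, hU, hUα⟩ := exists_isReversible_of_isPure hT hα hα1
    (isPure_of_pair_eq_one hT ha h) (T.isChannel_of_pair_eq_one h)
  exact ⟨U ≫ a, hT.pure_comp _ _ (isPure_of_isReversible hT hU) ha, by rw [pair_comp, hUα, h]⟩

/-- Purifications of the same state with different purifying systems are related by a pure channel
on the purifying system, up to a fixed pure state. -/
lemma exists_channel_of_marginal_eq {A B B' : C} {Ψ : 𝟙_ C ⟶ A ⊗ B} {Ψ' : 𝟙_ C ⟶ A ⊗ B'}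
    (hΨ : T.IsPure Ψ) (hΨ1 : T.IsChannel Ψ) (hΨ' : T.IsPure Ψ') (hΨ1' : T.IsChannel Ψ')
    (h : T.marginal Ψ = T.marginal Ψ') {b₀ : 𝟙_ C ⟶ B} (hb : T.IsPure b₀)
    (hb1 : T.IsChannel b₀) :
    ∃ V : B ⟶ B ⊗ B', T.IsPure V ∧ T.IsChannel V ∧
      Ψ ≫ A ◁ V = Ψ' ≫ A ◁ ((λ_ B').inv ≫ b₀ ▷ B') := by
  obtain ⟨b', hb', hb1'⟩ := exists_isPure_state hT B'
  have key : ∀ {D E : C} (Φ : 𝟙_ C ⟶ A ⊗ D) (f : D ⟶ E), T.IsPure Φ → T.IsChannel Φ →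
      T.marginal Φ = T.marginal Ψ → T.IsPure f → T.IsChannel f →
      T.IsPurification (Φ ≫ A ◁ f) (T.marginal Ψ) := by
    intro D E Φ f h1 h2 h3 h4 h5
    refine isPurification_iff.2 ⟨hT.pure_comp _ _ h1 (isPure_whiskerLeft hT A h4),
      isChannel_comp h2 (isChannel_whiskerLeft h5 A), ?_⟩
    rw [marginal_eq, contractRight_whiskerLeft, T.unit_comp h5, ← h3, marginal_eq]
  obtain ⟨U, hU, hUΨ⟩ := hT.purification_unique _ _ _
    (key Ψ ((ρ_ B).inv ≫ B ◁ b') hΨ hΨ1 rfl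
      (hT.pure_comp _ _ (isPure_of_isReversible hT (T.isReversible_right_inv B))
        (isPure_whiskerLeft hT B hb'))
      (isChannel_comp (T.isChannel_right_inv B) (isChannel_whiskerLeft hb1' B)))
    (key Ψ' ((λ_ B').inv ≫ b₀ ▷ B') hΨ' hΨ1' h.symm
      (hT.pure_comp _ _ (isPure_of_isReversible hT (T.isReversible_left_inv B'))
        (isPure_whiskerRight hT B' hb))
      (isChannel_comp (T.isChannel_left_inv B') (isChannel_whiskerRight hb1 B')))
  refine ⟨((ρ_ B).inv ≫ B ◁ b') ≫ U, ?_, ?_, ?_⟩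
  · exact hT.pure_comp _ _ (hT.pure_comp _ _
      (isPure_of_isReversible hT (T.isReversible_right_inv B)) (isPure_whiskerLeft hT B hb'))
      (isPure_of_isReversible hT hU)
  · exact isChannel_comp (isChannel_comp (T.isChannel_right_inv B)
      (isChannel_whiskerLeft hb1' B)) hU.1
  · rw [hUΨ, MonoidalCategory.whiskerLeft_comp, Category.assoc]

end CausalTheory

end OPT

/-! ### Fixed points of groups acting on finite-dimensional compact convex sets -/

namespace OPT

section FiniteDimensional

/-- On a finite-dimensional space of bounded functions, the values on a suitable finite set of
points control all values. -/
lemma exists_finset_sq_le {X : Type*} (V : Submodule ℝ (X → ℝ)) [FiniteDimensional ℝ V]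
    (hV : ∀ v ∈ V, ∃ M, ∀ x, |v x| ≤ M) :
    ∃ (t : Finset X) (c : ℝ), 0 < c ∧ ∀ v ∈ V, ∀ x, v x ^ 2 ≤ c * ∑ y ∈ t, v y ^ 2 := by
  classical
  let ev : X → Module.Dual ℝ V := fun x => (LinearMap.proj x).comp V.subtype
  have hfg : (Submodule.span ℝ (Set.range ev)).FG := IsNoetherian.noetherian _
  obtain ⟨s, hs, hspan⟩ := (Submodule.fg_span_iff_fg_span_finset_subset _).1 hfg
  obtain ⟨t, rfl⟩ : ∃ t : Finset X, t.image ev = s := by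
    have := (Finset.subset_set_image_iff (s := Set.univ)).1 (by rwa [Set.image_univ])
    obtain ⟨t, -, ht⟩ := this
    exact ⟨t, ht⟩
  -- Restriction to `t` is injective, and a left inverse recovers the other values.
  let R : V →ₗ[ℝ] (t → ℝ) := LinearMap.pi fun y => ev y
  have hR : Function.Injective R := by
    rw [← LinearMap.ker_eq_bot, LinearMap.ker_eq_bot']
    intro v hv
    have h1 : Submodule.span ℝ (Set.range ev) ≤ LinearMap.ker (Module.Dual.eval ℝ V v) := by
      rw [hspan, Submodule.span_le]
      intro φ hφ
      obtain ⟨y, hy, rfl⟩ := Finset.mem_image.1 (Finset.mem_coe.1 hφ)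
      exact congrFun hv ⟨y, hy⟩
    ext x
    exact h1 (Submodule.subset_span ⟨x, rfl⟩)
  obtain ⟨L, hL⟩ := LinearMap.exists_leftInverse_of_injective R (LinearMap.ker_eq_bot.2 hR)
  choose M hM using fun y : t => hV (L (Pi.single y 1)) (L (Pi.single y 1)).2
  refine ⟨t, ∑ y, M y ^ 2 + 1, by positivity, fun v hv x => ?_⟩
  have hv' : v x = ∑ y : t, v y * (L (Pi.single y 1) : X → ℝ) x := by
    have h1 : L (R ⟨v, hv⟩) = ⟨v, hv⟩ := LinearMap.congr_fun hL _
    have h2 : R ⟨v, hv⟩ = ∑ y : t, v y • Pi.single y (1 : ℝ) := by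
      rw [← Finset.univ_sum_single (R ⟨v, hv⟩)]
      refine Finset.sum_congr rfl fun y _ => ?_
      ext z
      by_cases h : z = y
      · subst h; simp [R, ev]
      · simp [h]
    have h3 := congrArg (fun w : V => (w : X → ℝ) x) h1
    rw [h2] at h3
    simpa using h3.symm
  have hb : ∑ y : t, (L (Pi.single y 1) : X → ℝ) x ^ 2 ≤ ∑ y, M y ^ 2 + 1 := by
    refine le_add_of_le_of_nonneg (Finset.sum_le_sum fun y _ => ?_) zero_le_one
    exact sq_le_sq' (by linarith [abs_le.1 (hM y x)]) (abs_le.1 (hM y x)).2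
  rw [hv', ← Finset.sum_coe_sort t]
  calc _ ≤ (∑ y : t, v y ^ 2) * ∑ y : t, (L (Pi.single y 1) : X → ℝ) x ^ 2 :=
        Finset.sum_mul_sq_le_sq_mul_sq _ _ _
    _ ≤ _ := by
        rw [mul_comm]
        gcongr

lemma exists_bound_of_mem_span {X : Type*} {K : Set (X → ℝ)} (hbd : ∀ f ∈ K, ∀ x, |f x| ≤ 1) :
    ∀ v ∈ Submodule.span ℝ K, ∃ M, ∀ x, |v x| ≤ M := by
  intro v hv
  induction hv using Submodule.span_induction with
  | mem v hv => exact ⟨1, hbd v hv⟩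
  | zero => exact ⟨0, by simp⟩
  | add v w _ _ hv hw =>
    obtain ⟨M, hM⟩ := hv
    obtain ⟨N, hN⟩ := hw
    exact ⟨M + N, fun x => (abs_add_le _ _).trans (add_le_add (hM x) (hN x))⟩
  | smul r v _ hv =>
    obtain ⟨M, hM⟩ := hv
    refine ⟨|r| * M, fun x => ?_⟩
    rw [Pi.smul_apply, smul_eq_mul, abs_mul]
    exact mul_le_mul_of_nonneg_left (hM x) (abs_nonneg r)

/-- A group of substitutions of variables that preserves a compact convex finite-dimensional set
of functions has a fixed point in it. The fixed point minimises the supremum over the group of a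
positive definite quadratic form: by uniform convexity of the form the minimiser is unique. -/
lemma exists_fixed_of_isCompact {X : Type*} {K : Set (X → ℝ)} (hK : IsCompact K)
    (hconv : Convex ℝ K) (hne : K.Nonempty) [FiniteDimensional ℝ (Submodule.span ℝ K)]
    (hbd : ∀ f ∈ K, ∀ x, |f x| ≤ 1) (G : Set (X → X)) (hid : id ∈ G)
    (hcomp : ∀ g ∈ G, ∀ h ∈ G, g ∘ h ∈ G) (hinv : ∀ g ∈ G, ∃ h ∈ G, ∀ x, g (h x) = x)
    (hGK : ∀ g ∈ G, ∀ f ∈ K, f ∘ g ∈ K) :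
    ∃ f ∈ K, ∀ g ∈ G, f ∘ g = f := by
  obtain ⟨t, c, hc, ht⟩ := exists_finset_sq_le (Submodule.span ℝ K) (exists_bound_of_mem_span hbd)
  let Q : (X → ℝ) → ℝ := fun f => ∑ y ∈ t, f y ^ 2
  have hQ1 : ∀ f ∈ K, Q f ≤ t.card := by
    intro f hf
    calc Q f ≤ ∑ y ∈ t, (1 : ℝ) := Finset.sum_le_sum fun y _ => by
          have := abs_le.1 (hbd f hf y); nlinarith
      _ = t.card := by simp
  have hbdd : ∀ f ∈ K, BddAbove (Set.range fun g : G => Q (f ∘ g)) := by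
    rintro f hf
    exact ⟨t.card, by rintro _ ⟨g, rfl⟩; exact hQ1 _ (hGK g g.2 f hf)⟩
  let N : (X → ℝ) → ℝ := fun f => ⨆ g : G, Q (f ∘ g)
  have hN : LowerSemicontinuousOn N K := by
    refine lowerSemicontinuousOn_ciSup hbdd fun g => ContinuousOn.lowerSemicontinuousOn ?_
    have : Continuous fun f : X → ℝ => ∑ y ∈ t, f (g.1 y) ^ 2 := by fun_prop
    exact this.continuousOn
  obtain ⟨f, hf, hmin⟩ := hN.exists_isMinOn hne hK
  refine ⟨f, hf, fun g₀ hg₀ => ?_⟩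
  by_contra hfg
  obtain ⟨x, hx⟩ := Function.ne_iff.1 hfg
  have : Nonempty G := ⟨⟨id, hid⟩⟩
  set m := N f
  -- the midpoint of `f` and its translate would have a smaller value
  have hmid : (1 / 2 : ℝ) • f + (1 / 2 : ℝ) • (f ∘ g₀) ∈ K :=
    hconv hf (hGK _ hg₀ f hf) (by norm_num) (by norm_num) (by norm_num)
  set d := (f (g₀ x) - f x) ^ 2 / c with hd
  have hd0 : 0 < d := div_pos (pow_two_pos_of_ne_zero (sub_ne_zero.2 hx)) hc
  have key : N ((1 / 2 : ℝ) • f + (1 / 2 : ℝ) • (f ∘ g₀)) ≤ m - d / 4 := by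
    refine ciSup_le fun g => ?_
    have h1 : Q (f ∘ g) ≤ m := le_ciSup (hbdd f hf) g
    have h2 : Q ((f ∘ g₀) ∘ g) ≤ m := le_ciSup (hbdd f hf) ⟨g₀ ∘ g, hcomp _ hg₀ _ g.2⟩
    have h3 : Q (((1 / 2 : ℝ) • f + (1 / 2 : ℝ) • (f ∘ g₀)) ∘ g) =
        (Q (f ∘ g) + Q ((f ∘ g₀) ∘ g)) / 2 - Q ((f ∘ g₀ - f) ∘ g) / 4 := by
      simp only [Q, ← Finset.sum_add_distrib, Finset.sum_div, ← Finset.sum_sub_distrib]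
      refine Finset.sum_congr rfl fun y _ => ?_
      simp only [Function.comp_apply, Pi.add_apply, Pi.smul_apply, smul_eq_mul, Pi.sub_apply]
      ring
    obtain ⟨h, -, hh⟩ := hinv g g.2
    have h4 : d ≤ Q ((f ∘ g₀ - f) ∘ g) := by
      have := ht ((f ∘ g₀) ∘ g - f ∘ g) (Submodule.sub_mem _
        (Submodule.subset_span (hGK _ g.2 _ (hGK _ hg₀ f hf)))
        (Submodule.subset_span (hGK _ g.2 f hf))) (h x)
      simp only [Pi.sub_apply, Function.comp_apply, hh] at this
      rw [hd, div_le_iff₀' hc]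
      exact this
    linarith
  have := hmin hmid
  simp only [Set.mem_ofPred_eq] at this
  linarith

end FiniteDimensional
end OPT

/-! ### The invariant state -/

namespace OPT

namespace CausalTheory

variable {C : Type u} [Category.{v} C] [MonoidalCategory C] [SymmetricCategory C]
  (T : CausalTheory C)

open CircuitData OperationalTheory

/-- `ρ` occurs with nonzero weight in a decomposition of `ω` into normalised states. -/
def IsComponent {A : C} (ρ ω : 𝟙_ C ⟶ A) : Prop :=
  ∃ p : ℝ, 0 < p ∧ p ≤ 1 ∧ ∃ τ : 𝟙_ C ⟶ A, T.IsChannel τ ∧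
    T.stateVec ω = p • T.stateVec ρ + (1 - p) • T.stateVec τ

variable {T}

/-- A finite subset of a convex set of normalised states has a common upper bound in it, for the
relation of occurring as a component. -/
lemma exists_forall_isComponent {A : C} (F : Set (𝟙_ C ⟶ A)) (hF1 : ∀ ρ ∈ F, T.IsChannel ρ)
    (hF : ∀ ρ ∈ F, ∀ σ ∈ F, ∀ ω, T.stateVec ω = (1 / 2 : ℝ) • T.stateVec ρ +
      (1 - 1 / 2 : ℝ) • T.stateVec σ → ω ∈ F) (hne : F.Nonempty)
    (t : Finset (𝟙_ C ⟶ A)) (ht : ∀ ρ ∈ t, ρ ∈ F) :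
    ∃ ω ∈ F, ∀ ρ ∈ t, T.IsComponent ρ ω := by
  classical
  induction t using Finset.induction with
  | empty =>
    obtain ⟨ρ, hρ⟩ := hne
    exact ⟨ρ, hρ, by simp⟩
  | insert ρ t _ ih =>
    obtain ⟨ω', hω', h⟩ := ih fun σ hσ => ht σ (Finset.mem_insert_of_mem hσ)
    have hρ := ht ρ (Finset.mem_insert_self _ _)
    obtain ⟨ω, hω, hm, -⟩ := T.exists_mixture (hF1 ρ hρ) (hF1 _ hω') (p := 1 / 2) (by norm_num)
    refine ⟨ω, hF _ hρ _ hω' _ hm, fun σ hσ => ?_⟩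
    rcases Finset.mem_insert.1 hσ with rfl | hσ
    · exact ⟨1 / 2, by norm_num, by norm_num, ω', hF1 _ hω', hm⟩
    · obtain ⟨p, hp, hp1, τ, hτ, hpτ⟩ := h σ hσ
      have hp2 : 0 < 1 - p / 2 := by linarith
      obtain ⟨τ', hτ', hτm, -⟩ := T.exists_mixture (hF1 ρ hρ) hτ (p := 1 / 2 / (1 - p / 2))
        ⟨by positivity, by rw [div_le_one hp2]; linarith⟩
      refine ⟨p / 2, by positivity, by linarith, τ', hτ', ?_⟩
      rw [hm, hτm, hpτ, smul_add, smul_add, smul_smul, smul_smul, smul_smul, smul_smul,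
        mul_div_cancel₀ _ hp2.ne', mul_sub (1 - p / 2), mul_div_cancel₀ _ hp2.ne', mul_one]
      module

lemma IsComponent.exists_le {A : C} {ρ ω : 𝟙_ C ⟶ A} (h : T.IsComponent ρ ω) :
    ∃ c : ℝ, ∀ e : A ⟶ 𝟙_ C, T.pair e ρ ≤ c * T.pair e ω := by
  obtain ⟨p, hp, hp1, τ, -, h⟩ := h
  refine ⟨p⁻¹, fun e => ?_⟩
  have h1 : T.pair e ω = p * T.pair e ρ + (1 - p) * T.pair e τ := congrFun h e
  have h2 := mul_nonneg (sub_nonneg.2 hp1) (T.pair_nonneg e τ)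
  rw [← div_eq_inv_mul, le_div_iff₀ hp]
  linarith

variable (hT : T.IsSharpWithPurification)
include hT

/-- The effects in the orbit of an effect that is certain on some pure state cannot all be
improbable on a suitable state. -/
lemma exists_forall_le_pair {A : C} {a : A ⟶ 𝟙_ C} {α : 𝟙_ C ⟶ A} (hα : T.IsPure α)
    (h : T.pair a α = 1) :
    ∃ (ω : 𝟙_ C ⟶ A) (c : ℝ), T.IsChannel ω ∧
      ∀ U : A ⟶ A, T.IsReversible U → 1 ≤ c * T.pair (U ≫ a) ω := by
  let X := {β : 𝟙_ C ⟶ A // T.IsPure β ∧ T.IsChannel β}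
  let S := Submodule.span ℝ (Set.range fun ρ : 𝟙_ C ⟶ A => T.stateVec ρ)
  have : FiniteDimensional ℝ S := T.finiteDimensional A
  let L : Module.Dual ℝ S →ₗ[ℝ] (X → ℝ) := LinearMap.pi fun β =>
    Module.Dual.eval ℝ S ⟨T.stateVec β.1, Submodule.subset_span ⟨_, rfl⟩⟩
  let K : Set (X → ℝ) := Set.range fun (e : A ⟶ 𝟙_ C) (β : X) => T.pair e β.1
  have hKL : Submodule.span ℝ K ≤ LinearMap.range L := by
    rw [Submodule.span_le]
    rintro _ ⟨e, rfl⟩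
    exact ⟨(LinearMap.proj e).comp S.subtype, rfl⟩
  have : FiniteDimensional ℝ (Submodule.span ℝ K) := Submodule.finiteDimensional_of_le hKL
  obtain ⟨t, c, hc, ht⟩ := exists_finset_sq_le (Submodule.span ℝ K) (exists_bound_of_mem_span (by
    rintro _ ⟨e, rfl⟩ β
    exact abs_le.2 ⟨by linarith [T.pair_nonneg e β.1], T.pair_le_one e β.1⟩))
  classical
  obtain ⟨ω, hω, hcomp⟩ := exists_forall_isComponent {ρ | T.IsChannel ρ} (fun _ h => h)
    (by
      intro ρ hρ σ hσ ω hω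
      rw [Set.mem_ofPred_eq, ← stateVec_mem_normStates, hω]
      exact T.convex_normStates A ⟨ρ, hρ, rfl⟩ ⟨σ, hσ, rfl⟩ (by norm_num) (by norm_num)
        (by norm_num))
    (exists_isChannel_state hT A) (t.image Subtype.val) (by
      intro ρ hρ
      obtain ⟨β, -, rfl⟩ := Finset.mem_image.1 hρ
      exact β.2.2)
  choose! m hm using fun (β : X) (hβ : β ∈ t) =>
    (hcomp β.1 (Finset.mem_image_of_mem _ hβ)).exists_le
  refine ⟨ω, c * ∑ β ∈ t, m β, hω, fun U hU => ?_⟩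
  obtain ⟨hU1, W, hW1, hUW, hWU⟩ := id hU
  have hWrev : T.IsReversible W := ⟨hW1, U, hU1, hWU, hUW⟩
  have h1 : T.pair (U ≫ a) (α ≫ W) = 1 := by
    rw [pair_comp, Category.assoc, hWU, Category.comp_id, h]
  have h2 := ht _ (Submodule.subset_span ⟨U ≫ a, rfl⟩)
    ⟨α ≫ W, isPure_comp_isReversible hα hWrev, T.isChannel_of_pair_eq_one h1⟩
  simp only [h1, one_pow] at h2
  rw [mul_assoc, Finset.sum_mul]
  refine h2.trans (mul_le_mul_of_nonneg_left (Finset.sum_le_sum fun β hβ => ?_) hc.le)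
  have h3 := T.pair_nonneg (U ≫ a) β.1
  have h4 := T.pair_le_one (U ≫ a) β.1
  have h5 := hm β hβ (U ≫ a)
  nlinarith

/-- There is a state that is invariant under all reversible channels, and on which a given
effect that is certain on some pure state has nonzero probability. -/
lemma exists_invariant_state {A : C} {a : A ⟶ 𝟙_ C} {α : 𝟙_ C ⟶ A} (hα : T.IsPure α)
    (h : T.pair a α = 1) :
    ∃ χ : 𝟙_ C ⟶ A, T.IsChannel χ ∧ (∀ U : A ⟶ A, T.IsReversible U → χ ≫ U = χ) ∧
      0 < T.pair a χ := by
  obtain ⟨ω, c, hω, hc⟩ := exists_forall_le_pair hT hα h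
  let K : Set ((A ⟶ 𝟙_ C) → ℝ) := T.normStates A ∩
    {f | ∀ U : A ⟶ A, T.IsReversible U → 1 ≤ c * f (U ≫ a)}
  have hclosed : IsClosed {f : (A ⟶ 𝟙_ C) → ℝ |
      ∀ U : A ⟶ A, T.IsReversible U → 1 ≤ c * f (U ≫ a)} := by
    simp only [Set.ofPred_forall]
    exact isClosed_iInter fun U => isClosed_iInter fun _ =>
      isClosed_le continuous_const (continuous_const.mul (continuous_apply _))
  have hconv : Convex ℝ {f : (A ⟶ 𝟙_ C) → ℝ |
      ∀ U : A ⟶ A, T.IsReversible U → 1 ≤ c * f (U ≫ a)} := by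
    intro f hf g hg s r hs hr hsr U hU
    have h1 := mul_le_mul_of_nonneg_left (hf U hU) hs
    have h2 := mul_le_mul_of_nonneg_left (hg U hU) hr
    simp only [Pi.add_apply, Pi.smul_apply, smul_eq_mul]
    linarith
  have : FiniteDimensional ℝ (Submodule.span ℝ K) := by
    have := T.finiteDimensional A
    refine Submodule.finiteDimensional_of_le
      (S₂ := Submodule.span ℝ (Set.range fun ρ : 𝟙_ C ⟶ A => T.stateVec ρ))
      (Submodule.span_mono ?_)
    rintro _ ⟨⟨ρ, -, rfl⟩, -⟩
    exact ⟨ρ, rfl⟩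
  have hrev_id : T.IsReversible (𝟙 A) :=
    ⟨T.isChannel_id A, 𝟙 A, T.isChannel_id A, by simp, by simp⟩
  have hrev_comp : ∀ {U V : A ⟶ A}, T.IsReversible U → T.IsReversible V →
      T.IsReversible (U ≫ V) := by
    rintro U V ⟨hU, U', hU', h1, h2⟩ ⟨hV, V', hV', h3, h4⟩
    exact ⟨isChannel_comp hU hV, V' ≫ U', isChannel_comp hV' hU',
      by simp [reassoc_of% h3, h1], by simp [reassoc_of% h2, h4]⟩
  obtain ⟨f, ⟨⟨χ, hχ, rfl⟩, hf⟩, hfix⟩ := exists_fixed_of_isCompact (K := K)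
    ((T.isCompact_normStates A).inter_right hclosed) ((T.convex_normStates A).inter hconv)
    ⟨_, ⟨ω, hω, rfl⟩, hc⟩
    (by
      rintro _ ⟨⟨ρ, -, rfl⟩, -⟩ e
      exact abs_le.2 ⟨by linarith [T.pair_nonneg e ρ, show T.stateVec ρ e = T.pair e ρ from rfl],
        T.pair_le_one e ρ⟩)
    {g | ∃ U : A ⟶ A, T.IsReversible U ∧ g = fun e => U ≫ e}
    ⟨𝟙 A, hrev_id, by funext e; simp⟩
    (by
      rintro _ ⟨U, hU, rfl⟩ _ ⟨V, hV, rfl⟩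
      exact ⟨U ≫ V, hrev_comp hU hV, by funext e; simp⟩)
    (by
      rintro _ ⟨U, ⟨hU, V, hV, h1, h2⟩, rfl⟩
      exact ⟨_, ⟨V, ⟨hV, U, hU, h2, h1⟩, rfl⟩, fun e => by simp [reassoc_of% h1]⟩)
    (by
      rintro _ ⟨U, hU, rfl⟩ _ ⟨⟨ρ, hρ, rfl⟩, hρ2⟩
      refine ⟨⟨ρ ≫ U, isChannel_comp hρ hU.1, ?_⟩, fun V hV => ?_⟩
      · funext e; simp [stateVec, pair]
      · simpa using hρ2 (U ≫ V) (hrev_comp hU hV))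
  refine ⟨χ, hχ, fun U hU => ?_, ?_⟩
  · apply T.eq_of_stateVec
    rw [← hfix _ ⟨U, hU, rfl⟩]
    funext e
    simp [stateVec, pair]
  · refine lt_of_le_of_ne (T.pair_nonneg _ _) fun h0 => ?_
    have := hf (𝟙 A) hrev_id
    rw [Category.id_comp, show T.stateVec χ a = T.pair a χ from rfl, ← h0] at this
    norm_num at this

end CausalTheory

end OPT

/-! ### Pure effects: uniqueness and perfect correlations -/

namespace OPT

namespace CausalTheory

variable {C : Type u} [Category.{v} C] [MonoidalCategory C] [SymmetricCategory C]
  {T : CausalTheory C}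

open CircuitData OperationalTheory

lemma isCoarseGraining_scale {A : C} {W X Y : Type} {s : W → (𝟙_ C ⟶ 𝟙_ C)} (hs : T.IsTest s)
    {c : X → (𝟙_ C ⟶ A)} {f : Y → (𝟙_ C ⟶ A)} {π : Y → X} (h : T.IsCoarseGraining c f π) :
    T.IsCoarseGraining (fun z : W × X => s z.1 ≫ c z.2) (fun z : W × Y => s z.1 ≫ f z.2)
      (Prod.map id π) := by
  classical
  have := T.finite_of_isTest f h.2.1
  have := Fintype.ofFinite Y
  have := T.finite_of_isTest s hs
  have := Fintype.ofFinite W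
  rw [isCoarseGraining_iff] at h ⊢
  refine ⟨T.isTest_comp _ _ hs h.1, T.isTest_comp _ _ hs h.2.1,
    Function.Surjective.prodMap Function.surjective_id h.2.2.1, ?_⟩
  rintro ⟨w, x⟩
  have h1 := h.2.2.2 x
  rw [T.vec_state_sum_one] at h1 ⊢
  rw [stateVec_scale, h1, Finset.sum_filter, Finset.smul_sum, Finset.sum_filter,
    Fintype.sum_prod_type]
  simp [Prod.ext_iff, ite_and, stateVec_scale]

/-- The normalisation of a pure state is pure. -/
lemma isPure_of_stateVec_eq_smul {A : C} {σ β : 𝟙_ C ⟶ A} {p : ℝ} (hσ : T.IsPure σ)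
    (hβ : T.IsChannel β) (hp : p ≠ 0) (h : T.stateVec σ = p • T.stateVec β) : T.IsPure β := by
  have hp' : p = T.pair (T.unit A) σ := by
    have := congrFun h (T.unit A)
    change T.pair _ _ = p * T.pair _ _ at this
    rw [this, T.pair_unit_of_isChannel hβ, mul_one]
  have hp01 : p ∈ Set.Icc (0 : ℝ) 1 := hp' ▸ ⟨T.pair_nonneg _ _, T.pair_le_one _ _⟩
  have hq01 : 1 - p ∈ Set.Icc (0 : ℝ) 1 := ⟨by linarith [hp01.2], by linarith [hp01.1]⟩
  refine T.isPure_of_extreme (mem_extremePoints_iff_left.2 ⟨⟨β, hβ, rfl⟩, ?_⟩)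
  rintro _ ⟨ρ, hρ, rfl⟩ _ ⟨τ, hτ, rfl⟩ ⟨a, b, ha, hb, hab, hβm⟩
  obtain ⟨ω, hω, hm, f, hf, -, hc⟩ := T.exists_mixture hρ hτ (p := a) ⟨ha.le, by linarith⟩
  have hωβ : ω = β := by
    apply T.eq_of_stateVec
    rw [hm, ← hβm, ← hab]; simp
  subst hωβ
  have hs : T.IsTest (fun w : Bool => cond w (T.scalar ⟨p, hp01⟩) (T.scalar ⟨1 - p, hq01⟩)) :=
    (T.isTest_scalar_iff _).2 (by simp)
  obtain ⟨r, -, -, hr⟩ := hσ _ _ _ _ _ (isCoarseGraining_scale hs hc) (true, ())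
    (T.eq_of_stateVec (by simp [stateVec_scale, h]))
  have h1 := T.vec_state_smul.1 (hr (true, true) rfl)
  simp only [stateVec_scale, cond_true, prob_scalar, hf, h, smul_smul] at h1
  have h2 := congrFun h1 (T.unit A)
  change _ * T.pair _ _ = _ * T.pair _ _ at h2
  rw [T.pair_unit_of_isChannel hρ, T.pair_unit_of_isChannel hω, mul_one, mul_one] at h2
  rw [← h2] at h1
  exact smul_right_injective _ (mul_ne_zero hp ha.ne') h1

variable (T) in
/-- The complement of an effect, such that both form a test. -/
lemma exists_complement {A : C} (a : A ⟶ 𝟙_ C) :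
    ∃ c : Bool → (A ⟶ 𝟙_ C), T.IsTest c ∧ c true = a ∧
      T.effectVec a + T.effectVec (c false) = T.effectVec (T.unit A) := by
  classical
  obtain ⟨X, f, x, hf, rfl⟩ := T.exists_isTest a
  have := T.finite_of_isTest f hf
  have := Fintype.ofFinite X
  have : Nonempty X := ⟨x⟩
  obtain ⟨c, hc, h⟩ := T.exists_bool_test hf (fun y => decide (y = x))
  have htrue : c true = f x := by
    apply T.vec_injective
    rw [h true]
    simp [Finset.sum_filter]
  refine ⟨c, hc, htrue, ?_⟩
  have := T.sum_effectVec_of_nonempty hc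
  simpa [htrue] using this

lemma pair_add_pair {A : C} {a a' : A ⟶ 𝟙_ C}
    (h : T.effectVec a + T.effectVec a' = T.effectVec (T.unit A)) (ρ : 𝟙_ C ⟶ A) :
    T.pair a ρ + T.pair a' ρ = T.pair (T.unit A) ρ := congrFun h ρ

lemma pair_eq_smul {A : C} {σ β : 𝟙_ C ⟶ A} {p : ℝ} (h : T.stateVec σ = p • T.stateVec β)
    (a : A ⟶ 𝟙_ C) : T.pair a σ = p * T.pair a β := congrFun h a

variable (hT : T.IsSharpWithPurification)
include hT

/-- Let the marginal of `Φ` be invariant, and let `a₀` and `a` be pure effects that are certain on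
some states, where `a` is at least as probable on the marginal as `a₀`. Then the probabilities
agree: a pure effect `b` that is certain on the state left by `a` leaves a multiple of a pure state,
whose weight is at least the probability of `a`, and at most that of an effect in the orbit of `a₀`.
Equality also shows that `b` prepares a multiple of the state on which `a` is certain. -/
lemma exists_correlated_effect_of_le {A B : C} {Φ : 𝟙_ C ⟶ A ⊗ B} (hΦ : T.IsPure Φ)
    (hinv : ∀ U : A ⟶ A, T.IsReversible U → T.marginal Φ ≫ U = T.marginal Φ)
    {a₀ : A ⟶ 𝟙_ C} {α₀ : 𝟙_ C ⟶ A} (ha₀ : T.IsPure a₀) (h₀ : T.pair a₀ α₀ = 1)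
    (hp : 0 < T.pair a₀ (T.marginal Φ)) {a : A ⟶ 𝟙_ C} {α : 𝟙_ C ⟶ A} (ha : T.IsPure a)
    (h : T.pair a α = 1) (hle : T.pair a₀ (T.marginal Φ) ≤ T.pair a (T.marginal Φ)) :
    T.pair a (T.marginal Φ) = T.pair a₀ (T.marginal Φ) ∧ ∃ b : B ⟶ 𝟙_ C,
      (∃ β, T.pair b β = 1 ∧
        T.stateVec (contractLeft a Φ) = T.pair a₀ (T.marginal Φ) • T.stateVec β) ∧
      T.IsPure b ∧
      T.stateVec (contractRight b Φ) = T.pair a₀ (T.marginal Φ) • T.stateVec α := by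
  have hunit : T.pair (T.unit B) (contractLeft a Φ) = T.pair a (T.marginal Φ) :=
    pair_contract a (T.unit B) Φ
  obtain ⟨β, hβ1, hβ⟩ := T.exists_normalisation (contractLeft a Φ)
    (by rw [hunit]; exact (hp.trans_le hle).ne')
  have hβp := isPure_of_stateVec_eq_smul (isPure_contractLeft hT ha hΦ) hβ1
    (by rw [hunit]; exact (hp.trans_le hle).ne') hβ
  obtain ⟨b, hb, hbβ⟩ := exists_isPure_effect hT hβp hβ1
  have hba : T.pair a (contractRight b Φ) = T.pair a (T.marginal Φ) := by
    rw [← pair_contract, pair_eq_smul hβ, hbβ, mul_one, hunit]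
  set κ := contractRight b Φ with hκ
  have hq : T.pair a (T.marginal Φ) ≤ T.pair (T.unit A) κ := hba ▸ T.pair_le_unit a κ
  have hq0 : T.pair (T.unit A) κ ≠ 0 := ((hp.trans_le hle).trans_le hq).ne'
  obtain ⟨α', hα'1, hα'⟩ := T.exists_normalisation κ hq0
  have hα'p := isPure_of_stateVec_eq_smul (isPure_contractRight hT hb hΦ) hα'1 hq0 hα'
  -- An effect in the orbit of `a₀` that is certain on `α'` bounds the weight of `α'`.
  have hq' : T.pair (T.unit A) κ ≤ T.pair a₀ (T.marginal Φ) := by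
    obtain ⟨U, hU, hUα⟩ := exists_isReversible_of_isPure hT hα'p hα'1
      (isPure_of_pair_eq_one hT ha₀ h₀) (T.isChannel_of_pair_eq_one h₀)
    have h1 : T.pair (U ≫ a₀) κ = T.pair (T.unit A) κ := by
      rw [pair_eq_smul hα', pair_comp, hUα, h₀, mul_one]
    rw [← h1, ← hinv U hU, ← pair_comp, hκ, ← pair_contract]
    exact (T.pair_le_unit b _).trans_eq (pair_contract _ _ _)
  have e1 : T.pair a (T.marginal Φ) = T.pair a₀ (T.marginal Φ) := by linarith
  have e2 : T.pair (T.unit A) κ = T.pair a₀ (T.marginal Φ) := by linarith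
  have hαα' : α' = α := by
    refine eq_of_pair_eq_one hT ha ?_ h
    rw [pair_eq_smul hα', e2, e1] at hba
    exact (mul_eq_left₀ hp.ne').1 hba
  refine ⟨e1, b, ⟨β, hbβ, ?_⟩, hb, ?_⟩
  · rw [hβ, hunit, e1]
  · rw [hα', e2, hαα']

/-- Every system has a purification `Φ` of a state invariant under reversible channels, for which
every pure effect that is certain on a state is perfectly correlated with a pure effect on the
purifying system, with a common probability `p`. -/
lemma exists_invariant_purification (A : C) :
    ∃ (B : C) (Φ : 𝟙_ C ⟶ A ⊗ B) (p : ℝ), T.IsPure Φ ∧ T.IsChannel Φ ∧ 0 < p ∧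
      (∀ U : A ⟶ A, T.IsReversible U → T.marginal Φ ≫ U = T.marginal Φ) ∧
      ∀ (a : A ⟶ 𝟙_ C) (α : 𝟙_ C ⟶ A), T.IsPure a → T.pair a α = 1 →
        T.pair a (T.marginal Φ) = p ∧ ∃ b : B ⟶ 𝟙_ C,
          (∃ β, T.pair b β = 1 ∧ T.stateVec (contractLeft a Φ) = p • T.stateVec β) ∧
          T.IsPure b ∧ T.stateVec (contractRight b Φ) = p • T.stateVec α := by
  obtain ⟨a₀, ha₀, α₀, h₀⟩ := hT.pure_sharpness A
  have hα₀ := isPure_of_pair_eq_one hT ha₀ h₀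
  obtain ⟨χ, hχ, hinv, hpos⟩ := exists_invariant_state hT hα₀ h₀
  obtain ⟨B, Φ, hΦ, hΦ1, rfl⟩ := exists_isPurification hT hχ
  refine ⟨B, Φ, T.pair a₀ (T.marginal Φ), hΦ, hΦ1, hpos, hinv, fun a α ha h => ?_⟩
  refine exists_correlated_effect_of_le hT hΦ hinv ha₀ h₀ hpos ha h ?_
  -- compare with an effect in the orbit of `a₀` that is certain on the same state
  obtain ⟨U, hU, hUα⟩ := exists_isReversible_of_isPure hT (isPure_of_pair_eq_one hT ha h)
    (T.isChannel_of_pair_eq_one h) hα₀ (T.isChannel_of_pair_eq_one h₀)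
  obtain ⟨-, b, -, -, hb⟩ := exists_correlated_effect_of_le hT hΦ hinv ha₀ h₀ hpos
    (a := U ≫ a₀) (α := α) (hT.pure_comp _ _ (isPure_of_isReversible hT hU) ha₀)
    (by rw [pair_comp, hUα, h₀]) (by rw [pair_comp, hinv U hU])
  have h1 : T.pair a (contractRight b Φ) = T.pair a₀ (T.marginal Φ) := by
    rw [pair_eq_smul hb, h, mul_one]
  rw [← h1, ← pair_contract]
  exact (T.pair_le_unit b _).trans_eq (pair_contract _ _ _)

/-- Every system `A` has a pure state of `A ⊗ B` on which effects of `A` act faithfully. -/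
lemma exists_faithful (A : C) :
    ∃ (B : C) (Φ : 𝟙_ C ⟶ A ⊗ B), T.IsPure Φ ∧ T.IsChannel Φ ∧
      ∀ a b : A ⟶ 𝟙_ C, contractLeft a Φ = contractLeft b Φ → a = b := by
  obtain ⟨B, Φ, p, hΦ, hΦ1, hp, -, hcor⟩ := exists_invariant_purification hT A
  refine ⟨B, Φ, hΦ, hΦ1, fun a b hab => effect_ext_of_isPure (T := T) fun α hα hα1 => ?_⟩
  obtain ⟨e, he, heα⟩ := exists_isPure_effect hT hα hα1
  obtain ⟨-, f, -, -, hf⟩ := hcor e α he heα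
  have h1 := pair_contract a f Φ (T := T)
  have h2 := pair_contract b f Φ (T := T)
  rw [pair_eq_smul hf] at h1 h2
  rw [hab, h2] at h1
  exact (mul_left_cancel₀ hp.ne' h1).symm

/-- A state is accepted with certainty by at most one pure effect. -/
lemma effect_eq_of_pair_eq_one {A : C} {a a' : A ⟶ 𝟙_ C} {α : 𝟙_ C ⟶ A} (ha : T.IsPure a)
    (ha' : T.IsPure a') (h : T.pair a α = 1) (h' : T.pair a' α = 1) : a = a' := by
  obtain ⟨B, Φ, p, hΦ, hΦ1, hp, -, hcor⟩ := exists_invariant_purification hT A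
  obtain ⟨-, b, ⟨β, hbβ, hβ⟩, hb, hbα⟩ := hcor a α ha h
  obtain ⟨-, b', ⟨β', hbβ', hβ'⟩, hb', hbα'⟩ := hcor a' α ha' h'
  have h1 : T.pair b' β = 1 := by
    have h2 := pair_contract a b' Φ (T := T)
    rw [pair_eq_smul hβ, pair_eq_smul hbα', h] at h2
    exact mul_left_cancel₀ hp.ne' h2
  have hββ : β = β' := eq_of_pair_eq_one hT hb' h1 hbβ'
  refine effect_ext_of_isPure (T := T) fun γ hγ hγ1 => ?_
  obtain ⟨e, he, heγ⟩ := exists_isPure_effect hT hγ hγ1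
  obtain ⟨-, f, -, -, hf⟩ := hcor e γ he heγ
  have h2 := pair_contract a f Φ (T := T)
  have h3 := pair_contract a' f Φ (T := T)
  rw [pair_eq_smul hf, pair_eq_smul hβ] at h2
  rw [pair_eq_smul hf, pair_eq_smul hβ', ← hββ, h2] at h3
  exact mul_left_cancel₀ hp.ne' h3

/-- A system with two different normalised states has two perfectly distinguishable states. The
second one is the rest of the invariant state when the maximal multiple of a pure state is
removed. -/
lemma exists_distinguishable {A : C} {ρ σ : 𝟙_ C ⟶ A} (hρ : T.IsChannel ρ) (hσ : T.IsChannel σ)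
    (hne : ρ ≠ σ) :
    ∃ (r : A ⟶ 𝟙_ C) (ξ ξ' : 𝟙_ C ⟶ A), T.IsPure r ∧ T.pair r ξ = 1 ∧ T.IsChannel ξ' ∧
      T.pair r ξ' = 0 := by
  obtain ⟨B, Φ, p, hΦ, hΦ1, hp, hinv, hcor⟩ := exists_invariant_purification hT A
  obtain ⟨a, ha, α, h⟩ := hT.pure_sharpness A
  obtain ⟨hap, b, -, -, hb⟩ := hcor a α ha h
  have hα := isPure_of_pair_eq_one hT ha h
  have hα1 := T.isChannel_of_pair_eq_one h
  have hp1 : p ≠ 1 := by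
    rintro rfl
    -- otherwise the invariant state is pure, and is the only state
    have h1 : T.marginal Φ = α := eq_of_pair_eq_one hT ha hap h
    have h2 : ∀ x ∈ (T.normStates A).extremePoints ℝ, x = T.stateVec α := by
      intro x hx
      obtain ⟨β, hβ, rfl⟩ := extremePoints_subset hx
      obtain ⟨U, hU, rfl⟩ := exists_isReversible_of_isPure hT hα hα1 (T.isPure_of_extreme hx) hβ
      rw [← h1, hinv U hU]
    have h3 : T.normStates A ⊆ {T.stateVec α} := by
      rw [← closure_convexHull_extremePoints (T.isCompact_normStates A) (T.convex_normStates A)]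
      exact closure_minimal (convexHull_min h2 (convex_singleton _)) isClosed_singleton
    exact hne (T.eq_of_stateVec ((h3 ⟨ρ, hρ, rfl⟩).trans (h3 ⟨σ, hσ, rfl⟩).symm))
  obtain ⟨c, hc, hcb, hcu⟩ := T.exists_complement b
  have hrest : ∀ e : A ⟶ 𝟙_ C, T.pair e (contractRight (c false) Φ) =
      T.pair e (T.marginal Φ) - p * T.pair e α := by
    intro e
    have := pair_add_pair hcu (contractLeft e Φ)
    rw [pair_contract, pair_contract, pair_contract, pair_eq_smul hb, ← marginal_eq] at this
    linarith
  have hu : T.pair (T.unit A) (contractRight (c false) Φ) = 1 - p := by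
    rw [hrest, T.pair_unit_of_isChannel hα1,
      T.pair_unit_of_isChannel (isChannel_marginal hΦ1), mul_one]
  obtain ⟨τ, hτ, hτe⟩ := T.exists_normalisation (contractRight (c false) Φ)
    (by rw [hu]; exact sub_ne_zero.2 hp1.symm)
  refine ⟨a, α, τ, ha, h, hτ, ?_⟩
  have h4 := hrest a
  rw [pair_eq_smul hτe, hu, hap, h, mul_one, sub_self] at h4
  exact (mul_eq_zero.1 h4).resolve_left (sub_ne_zero.2 hp1.symm)

end CausalTheory

end OPT

/-! ### Steering, and pure transformations that do not disturb a face -/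

namespace OPT

section Contract

variable {C : Type u} [Category.{v} C] [MonoidalCategory C]

lemma contractRight_assoc {A R F : C} (f : F ⟶ 𝟙_ C) (e : R ⟶ 𝟙_ C) (Ω : 𝟙_ C ⟶ (A ⊗ R) ⊗ F) :
    contractRight (R ◁ f ≫ (ρ_ R).hom ≫ e) (Ω ≫ (α_ A R F).hom) =
      contractRight e (contractRight f Ω) := by
  simp [contractRight]

end Contract

namespace CausalTheory

variable {C : Type u} [Category.{v} C] [MonoidalCategory C] [SymmetricCategory C]
  {T : CausalTheory C}

open CircuitData OperationalTheory

lemma unit_tensor (A B : C) : T.unit (A ⊗ B) = A ◁ T.unit B ≫ (ρ_ A).hom ≫ T.unit A :=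
  (T.eq_unit _ (isChannel_comp (isChannel_whiskerLeft (T.isChannel_unit B) A)
    (isChannel_comp (T.isChannel_right A) (T.isChannel_unit A)))).symm

lemma stateVec_contractRight_mixture {A B : C} {σ ρ τ : 𝟙_ C ⟶ A ⊗ B} {p q : ℝ}
    (h : T.stateVec σ = p • T.stateVec ρ + q • T.stateVec τ) (b : B ⟶ 𝟙_ C) :
    T.stateVec (contractRight b σ) =
      p • T.stateVec (contractRight b ρ) + q • T.stateVec (contractRight b τ) := by
  funext e
  simpa [stateVec, pair, contractRight] using congrFun h (A ◁ b ≫ (ρ_ A).hom ≫ e)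

variable (hT : T.IsSharpWithPurification)
include hT

/-- Steering: every component of the marginal of a pure state can be prepared by an effect on the
purifying system. A register with two perfectly distinguishable states is used to purify the
decomposition together with a record of its outcome. -/
lemma exists_steering {A B R : C} {r : R ⟶ 𝟙_ C} {ξ ξ' : 𝟙_ C ⟶ R} (hr : T.pair r ξ = 1)
    (hξ' : T.IsChannel ξ') (hr' : T.pair r ξ' = 0) {Ψ : 𝟙_ C ⟶ A ⊗ B} (hΨ : T.IsPure Ψ)
    (hΨ1 : T.IsChannel Ψ) {ρ : 𝟙_ C ⟶ A} (hρ : T.IsChannel ρ)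
    (h : T.IsComponent ρ (T.marginal Ψ)) :
    ∃ (c : B ⟶ 𝟙_ C) (p : ℝ), p ≠ 0 ∧ T.stateVec (contractRight c Ψ) = p • T.stateVec ρ := by
  obtain ⟨p, hp, hp1, τ, hτ, hm⟩ := h
  have hξ := T.isChannel_of_pair_eq_one hr
  obtain ⟨σ, hσ, hσm, -⟩ := T.exists_mixture (isChannel_prodState hρ hξ)
    (isChannel_prodState hτ hξ') (p := p) ⟨hp.le, hp1⟩
  obtain ⟨F, Ω, hΩ, hΩ1, rfl⟩ := exists_isPurification hT hσ
  have hmarg : T.marginal (Ω ≫ (α_ A R F).hom) = T.marginal Ψ := by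
    rw [marginal_eq, unit_tensor, contractRight_assoc]
    apply T.eq_of_stateVec
    rw [← marginal_eq Ω, stateVec_contractRight_mixture hσm, contractRight_prodState,
      contractRight_prodState, comp_unit_state hξ, comp_unit_state hξ', hm, Category.id_comp,
      Category.id_comp]
  obtain ⟨b₀, hb₀, hb₀1⟩ := exists_isPure_state hT B
  obtain ⟨V, -, -, hV⟩ := exists_channel_of_marginal_eq hT hΨ hΨ1
    (isPure_comp_isReversible hΩ (T.isReversible_assoc A R F))
    (isChannel_comp hΩ1 (T.isChannel_assoc A R F)) hmarg.symm hb₀ hb₀1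
  refine ⟨V ≫ T.unit B ▷ (R ⊗ F) ≫ (λ_ _).hom ≫ R ◁ T.unit F ≫ (ρ_ R).hom ≫ r, p, hp.ne', ?_⟩
  have h1 : ((λ_ (R ⊗ F)).inv ≫ b₀ ▷ (R ⊗ F)) ≫ T.unit B ▷ (R ⊗ F) ≫ (λ_ _).hom = 𝟙 _ := by
    rw [Category.assoc, ← comp_whiskerRight_assoc, comp_unit_state hb₀1]
    simp
  rw [← contractRight_whiskerLeft, hV, contractRight_whiskerLeft,
    Category.assoc (λ_ (R ⊗ F)).inv, reassoc_of% h1, contractRight_assoc,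
    ← marginal_eq Ω, stateVec_contractRight_mixture hσm, contractRight_prodState,
    contractRight_prodState, stateVec_scale, stateVec_scale]
  change p • T.pair r ξ • _ + (1 - p) • T.pair r ξ' • _ = _
  rw [hr, hr', one_smul, zero_smul, smul_zero, add_zero]

/-- Every effect is the effect of a pure transformation followed by discarding. The measurement of
the effect with the outcome written in a register is purified, and the register is then projected
by a pure effect. -/
lemma exists_pure_test {A R : C} {r : R ⟶ 𝟙_ C} {ξ ξ' : 𝟙_ C ⟶ R} (hrp : T.IsPure r)
    (hr : T.pair r ξ = 1) (hξ' : T.IsChannel ξ') (hr' : T.pair r ξ' = 0) (a : A ⟶ 𝟙_ C) :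
    ∃ (E : C) (f : Bool → (A ⟶ E)), T.IsTest f ∧ T.IsPure (f true) ∧
      f true ≫ T.unit E = a := by
  classical
  have hξ := T.isChannel_of_pair_eq_one hr
  obtain ⟨c, hc, rfl, -⟩ := T.exists_complement a
  -- the channel that measures `c` and writes the outcome in `R`
  obtain ⟨M', hM'⟩ := T.exists_coarseGraining _ (fun _ => ())
    (T.isTest_bind (g := fun b (_ : Unit) => cond b ξ ξ') hc
      (by rintro (_ | _) <;> assumption)) (fun _ => ⟨(true, ()), rfl⟩)
  obtain ⟨M, rfl⟩ : ∃ M, M' = fun _ => M := ⟨M' (), rfl⟩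
  have hM : T.IsChannel M := hM'.1
  have hMr : M ≫ r = c true := by
    apply T.eq_of_effectVec
    funext ρ
    rw [isCoarseGraining_iff] at hM'
    have h1 := T.vec_state_sum_one.1 ((T.reindexes_comp_left ρ).vec_sum_one (hM'.2.2.2 ()))
    have h2 := congrFun h1 r
    have h3 : ∀ (b : Bool) (x : 𝟙_ C ⟶ R), T.stateVec (ρ ≫ c b ≫ x) r =
        T.pair (c b) ρ * T.pair r x := by
      intro b x
      rw [← Category.assoc, stateVec_scale]; rfl
    change T.pair (M ≫ r) ρ = T.pair (c true) ρ
    rw [pair_comp]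
    refine h2.trans ?_
    simp [Fintype.sum_prod_type, h3, hr, hr']
  obtain ⟨B, Φ₀, hΦ₀, hΦ₀1, hfaith⟩ := exists_faithful hT A
  set Φ := Φ₀ ≫ (β_ A B).hom with hΦdef
  have hΦ : T.IsPure Φ := isPure_comp_isReversible hΦ₀ (T.isReversible_swap A B)
  have hΦ1 : T.IsChannel Φ := isChannel_comp hΦ₀1 (T.isChannel_swap A B)
  obtain ⟨F, Ω, hΩ, hΩ1, hΩM⟩ := exists_isPurification hT
    (isChannel_comp hΦ1 (isChannel_whiskerLeft hM B))
  have hmarg : T.marginal (Ω ≫ (α_ B R F).hom) = T.marginal Φ := by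
    rw [marginal_eq, unit_tensor, contractRight_assoc, ← marginal_eq Ω, hΩM,
      contractRight_whiskerLeft, T.unit_comp hM, marginal_eq]
  obtain ⟨a₀, ha₀, ha₀1⟩ := exists_isPure_state hT A
  obtain ⟨V, hVp, hV1, hV⟩ := exists_channel_of_marginal_eq hT hΦ hΦ1
    (isPure_comp_isReversible hΩ (T.isReversible_assoc B R F))
    (isChannel_comp hΩ1 (T.isChannel_assoc B R F)) hmarg.symm ha₀ ha₀1
  obtain ⟨d, hd, hdr, -⟩ := T.exists_complement r
  refine ⟨A ⊗ F, fun b => V ≫ A ◁ (d b ▷ F ≫ (λ_ F).hom), ?_, ?_, ?_⟩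
  · exact ((T.isContext_comp_left hV1).comp ((T.isContext_whiskerLeft _ _ A).comp
      ((T.isContext_comp_right (T.isChannel_left F)).comp
        (T.isContext_whiskerRight _ _ F)))).1 _ hd
  · beta_reduce
    rw [hdr]
    exact hT.pure_comp _ _ hVp (isPure_whiskerLeft hT A (hT.pure_comp _ _
      (isPure_whiskerRight hT F hrp) (isPure_of_isReversible hT (T.isReversible_left F))))
  · beta_reduce
    apply hfaith
    rw [← contractRight_swap, ← contractRight_swap, ← hΦdef, hdr]
    have h1 : ((λ_ (R ⊗ F)).inv ≫ a₀ ▷ (R ⊗ F)) ≫ A ◁ (r ▷ F ≫ (λ_ F).hom) ≫ T.unit (A ⊗ F) =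
        R ◁ T.unit F ≫ (ρ_ R).hom ≫ r := by
      have h2 : (λ_ F).inv ≫ a₀ ▷ F ≫ T.unit (A ⊗ F) = T.unit F := by
        rw [← Category.assoc]
        exact T.unit_comp (isChannel_comp (T.isChannel_left_inv F)
          (isChannel_whiskerRight ha₀1 F))
      rw [Category.assoc, ← whisker_exchange_assoc, ← leftUnitor_inv_naturality_assoc, h2,
        Category.assoc, ← leftUnitor_naturality, ← whisker_exchange_assoc, unitors_equal,
        rightUnitor_naturality]
    rw [Category.assoc, ← contractRight_whiskerLeft, hV, contractRight_whiskerLeft, h1,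
      contractRight_assoc, ← marginal_eq Ω, hΩM, contractRight_whiskerLeft, hMr]

/-- For every effect `a` that is certain on some state there is a pure transformation that fixes
all states on which `a` is certain. It is part of a two-step test whose first step measures
`a`. -/
lemma exists_nondisturbing {A : C} (a : A ⟶ 𝟙_ C) {ρ₀ : 𝟙_ C ⟶ A} (h₀ : T.pair a ρ₀ = 1) :
    ∃ (E : C) (f : Bool → (A ⟶ E)) (g : Bool → (E ⟶ A)), T.IsTest f ∧ T.IsTest g ∧
      f true ≫ T.unit E = a ∧ T.IsPure (f true ≫ g true) ∧
      ∀ ρ : 𝟙_ C ⟶ A, T.pair a ρ = 1 → ρ ≫ f true ≫ g true = ρ := by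
  classical
  by_cases hau : a = T.unit A
  · let s : Bool → (𝟙_ C ⟶ 𝟙_ C) := fun b => cond b (𝟙 _) (T.scalar ⟨0, by simp⟩)
    have hs := T.isTest_scale s (by simp [s, T.prob_id]) A
    have h1 : scale (s true) A = 𝟙 A := by simp [scale, s]
    refine ⟨A, _, _, hs, hs, ?_, ?_, ?_⟩
    · rw [h1, hau, Category.id_comp]
    · rw [h1, Category.id_comp]; exact isPure_id hT A
    · simp [h1]
  -- `A` has at least two states, so it can be used as a register.
  obtain ⟨r, ξ, ξ', hrp, hr, hξ', hr'⟩ : ∃ (r : A ⟶ 𝟙_ C) (ξ ξ' : 𝟙_ C ⟶ A), T.IsPure r ∧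
      T.pair r ξ = 1 ∧ T.IsChannel ξ' ∧ T.pair r ξ' = 0 := by
    by_contra hcon
    apply hau
    have hone : ∀ ρ : 𝟙_ C ⟶ A, T.IsChannel ρ → ρ = ρ₀ := by
      intro ρ hρ
      by_contra hne
      exact hcon (exists_distinguishable hT hρ (T.isChannel_of_pair_eq_one h₀) hne)
    refine effect_ext_of_isPure (T := T) fun α _ hα => ?_
    rw [hone α hα, h₀, T.pair_unit_of_isChannel (T.isChannel_of_pair_eq_one h₀)]
  obtain ⟨E, f, hf, hfp, hfa⟩ := exists_pure_test hT hrp hr hξ' hr' a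
  -- a state `ω` of the face that has a spanning set of the face as components
  have hfg : (Submodule.span ℝ (T.stateVec '' {ρ : 𝟙_ C ⟶ A | T.pair a ρ = 1})).FG := by
    have := T.finiteDimensional A
    have : FiniteDimensional ℝ
        (Submodule.span ℝ (T.stateVec '' {ρ : 𝟙_ C ⟶ A | T.pair a ρ = 1})) :=
      Submodule.finiteDimensional_of_le (S₂ := Submodule.span ℝ
        (Set.range fun ρ : 𝟙_ C ⟶ A => T.stateVec ρ))
        (Submodule.span_mono (Set.image_subset_range _ _))
    exact Module.Finite.iff_fg.1 this
  obtain ⟨s, hs, hspan⟩ := (Submodule.fg_span_iff_fg_span_finset_subset _).1 hfg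
  obtain ⟨t, ht, rfl⟩ := Finset.subset_set_image_iff.1 hs
  obtain ⟨ω, hω, hcomp⟩ := exists_forall_isComponent {ρ : 𝟙_ C ⟶ A | T.pair a ρ = 1}
    (fun ρ hρ => T.isChannel_of_pair_eq_one hρ)
    (by
      intro ρ hρ σ hσ ω hω
      have h1 : T.pair a ω = _ := congrFun hω a
      have h2 : T.stateVec ρ a = 1 := hρ
      have h3 : T.stateVec σ a = 1 := hσ
      rw [Set.mem_ofPred_eq, h1, Pi.add_apply, Pi.smul_apply, Pi.smul_apply, h2, h3]
      norm_num)
    ⟨ρ₀, h₀⟩ t (fun ρ hρ => ht hρ)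
  obtain ⟨B, Ψ₀, hΨ₀, hΨ₀1, rfl⟩ := exists_isPurification hT (T.isChannel_of_pair_eq_one hω)
  set Ψ := Ψ₀ ≫ (β_ A B).hom with hΨdef
  have hΨ : T.IsPure Ψ := isPure_comp_isReversible hΨ₀ (T.isReversible_swap A B)
  have hΨ1 : T.IsChannel Ψ := isChannel_comp hΨ₀1 (T.isChannel_swap A B)
  -- `f true` does not change the marginal of the purifying system, hence can be reversed on `Ψ`
  have hmarg : T.marginal (Ψ ≫ B ◁ f true) = T.marginal Ψ := by
    rw [marginal_eq, contractRight_whiskerLeft, hfa, contractRight_swap,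
      contractLeft_eq_unit hΨ₀1 hω, marginal_eq, contractRight_swap]
  have hfΨ1 : T.IsChannel (Ψ ≫ B ◁ f true) := by
    refine T.isChannel_of_pair_unit ?_
    rw [unit_tensor]
    have := T.pair_unit_of_isChannel (isChannel_marginal hΨ1)
    rw [← hmarg] at this
    simpa [pair, marginal] using this
  obtain ⟨e₀, he₀, he₀1⟩ := exists_isPure_state hT E
  obtain ⟨e, he, hee₀⟩ := exists_isPure_effect hT he₀ he₀1
  obtain ⟨V, hVp, hV1, hV⟩ := exists_channel_of_marginal_eq hT
    (hT.pure_comp _ _ hΨ (isPure_whiskerLeft hT B hfp)) hfΨ1 hΨ hΨ1 hmarg he₀ he₀1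
  obtain ⟨d, hd, hde, -⟩ := T.exists_complement e
  refine ⟨E, f, fun b => V ≫ d b ▷ A ≫ (λ_ A).hom, hf, ?_, hfa, ?_, ?_⟩
  · exact ((T.isContext_comp hV1 (T.isChannel_left A)).comp (T.isContext_whiskerRight _ _ A)).1 _ hd
  · beta_reduce
    rw [hde]
    exact hT.pure_comp _ _ hfp (hT.pure_comp _ _ hVp (hT.pure_comp _ _
      (isPure_whiskerRight hT A he) (isPure_of_isReversible hT (T.isReversible_left A))))
  set P := f true ≫ V ≫ d true ▷ A ≫ (λ_ A).hom with hP
  have hPΨ : Ψ ≫ B ◁ P = Ψ := by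
    have h1 : ((λ_ A).inv ≫ e₀ ▷ A) ≫ e ▷ A ≫ (λ_ A).hom = 𝟙 A := by
      rw [Category.assoc, ← comp_whiskerRight_assoc, scalar_eq_id (T := T) hee₀]
      simp
    have h2 : Ψ ≫ B ◁ P = ((Ψ ≫ B ◁ f true) ≫ B ◁ V) ≫ B ◁ (e ▷ A ≫ (λ_ A).hom) := by
      simp [hP, hde]
    rw [h2, hV, Category.assoc, ← MonoidalCategory.whiskerLeft_comp, h1]
    simp
  have hfix : ∀ ρ ∈ t, ∀ x : A ⟶ 𝟙_ C, T.stateVec ρ (P ≫ x) = T.stateVec ρ x := by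
    intro ρ hρ x
    obtain ⟨c, p, hp, hc⟩ := exists_steering hT hr hξ' hr' hΨ₀ hΨ₀1
      (T.isChannel_of_pair_eq_one (ht hρ)) (hcomp ρ hρ)
    have h1 : contractLeft c Ψ ≫ P = contractLeft c Ψ := by
      rw [← contractLeft_whiskerLeft, hPΨ]
    rw [hΨdef, contractLeft_swap] at h1
    have h2 : T.stateVec (contractRight c Ψ₀) (P ≫ x) = T.stateVec (contractRight c Ψ₀) x := by
      simp only [stateVec, pair_comp, h1]
    rw [hc] at h2
    exact mul_left_cancel₀ hp h2
  let W : Submodule ℝ ((A ⟶ 𝟙_ C) → ℝ) :=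
    { carrier := {v | ∀ x, v (P ≫ x) = v x}
      add_mem' := fun hv hw x => by simp [hv x, hw x]
      zero_mem' := fun x => rfl
      smul_mem' := fun c v hv x => by simp [hv x] }
  have hW : Submodule.span ℝ (T.stateVec '' {ρ : 𝟙_ C ⟶ A | T.pair a ρ = 1}) ≤ W := by
    rw [hspan, Submodule.span_le]
    intro v hv
    obtain ⟨ρ, hρ, rfl⟩ := Finset.mem_image.1 (Finset.mem_coe.1 hv)
    exact hfix ρ hρ
  intro ρ hρ
  apply T.eq_of_stateVec
  funext x
  have : T.stateVec ρ ∈ W := hW (Submodule.subset_span ⟨ρ, hρ, rfl⟩)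
  rw [← this x]
  simp [stateVec, pair, hP]

end CausalTheory

end OPT

/-! ### Orthogonal pure states and the projectors -/

namespace OPT

namespace CausalTheory

variable {C : Type u} [Category.{v} C] [MonoidalCategory C] [SymmetricCategory C]
  {T : CausalTheory C}

open CircuitData OperationalTheory

lemma isPure_of_vec_eq_zero {A B : C} {g : A ⟶ B} (hg : T.vec g = 0) : T.IsPure g := by
  classical
  intro X Y c f π h x hx
  have := T.finite_of_isTest f h.2.1
  have := Fintype.ofFinite Y
  rw [isCoarseGraining_iff] at h
  obtain ⟨y₀, hy₀⟩ := h.2.2.1 x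
  have hsum := h.2.2.2 x
  rw [hx, hg] at hsum
  refine ⟨Pi.single y₀ 1, fun y _ => ?_, ?_, fun y hy => ?_⟩
  · by_cases h : y = y₀
    · subst h; simp
    · simp [h]
  · have hcoe : π ⁻¹' {x} = (({y | π y = x} : Finset Y) : Set Y) := by ext y; simp
    rw [hcoe, finsum_mem_coe_finset]
    simp [Finset.sum_pi_single', hy₀]
  · rw [hg, smul_zero]
    funext S σ e
    have h1 := congrFun (congrFun (congrFun hsum S) σ) e
    simp only [Finset.sum_apply, Pi.zero_apply] at h1
    exact (Finset.sum_eq_zero_iff_of_nonneg (fun y _ => T.prob_nonneg _)).1 h1.symm y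
      (by simpa using hy)

lemma effectVec_apply {A : C} (a : A ⟶ 𝟙_ C) (ρ : 𝟙_ C ⟶ A) : T.effectVec a ρ = T.pair a ρ := rfl

lemma pair_comp_le {A E : C} {f : A ⟶ E} {a : A ⟶ 𝟙_ C} (h : f ≫ T.unit E = a) (g : E ⟶ A)
    (e : A ⟶ 𝟙_ C) (ρ : 𝟙_ C ⟶ A) : T.pair e (ρ ≫ f ≫ g) ≤ T.pair a ρ := by
  have h1 := T.pair_le_unit (g ≫ e) (ρ ≫ f)
  rwa [pair_comp, ← pair_comp T f, h, Category.assoc] at h1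

variable (hT : T.IsSharpWithPurification)
include hT

lemma exists_isDagger {A : C} {α : 𝟙_ C ⟶ A} (hα : T.IsPure α) (hα1 : T.IsChannel α) :
    ∃ a : A ⟶ 𝟙_ C, T.IsDagger α a := by
  obtain ⟨a, ha, h⟩ := exists_isPure_effect hT hα hα1
  refine ⟨a, ⟨ha, ?_, h⟩, fun b hb _ hbα => effect_eq_of_pair_eq_one hT hb ha hbα h⟩
  have : Nonempty (𝟙_ C ⟶ A) := ⟨α⟩
  refine le_antisymm (ciSup_le fun ρ => T.pair_le_one a ρ) ?_
  rw [← h]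
  exact le_ciSup (f := fun ρ => T.pair a ρ) ⟨1, by rintro _ ⟨ρ, rfl⟩; exact T.pair_le_one _ _⟩ α

/-- A pure effect that is certain on a fixed state of a pure transformation is invariant. -/
lemma comp_eq_of_comp_eq {A : C} {P : A ⟶ A} {α : 𝟙_ C ⟶ A} {b : A ⟶ 𝟙_ C} (hP : T.IsPure P)
    (hb : T.IsPure b) (h : T.pair b α = 1) (hα : α ≫ P = α) : P ≫ b = b :=
  effect_eq_of_pair_eq_one hT (hT.pure_comp _ _ hP hb) hb (by rw [pair_comp, hα, h]) h

/-- If an effect accepts `α` with certainty and never accepts `β`, then neither does the pure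
effect that accepts `α` with certainty. -/
lemma pair_eq_zero_of_separates {A : C} {a b : A ⟶ 𝟙_ C} {α β : 𝟙_ C ⟶ A}
    (hα : T.pair a α = 1) (hβ : T.pair a β = 0) (hb : T.IsPure b) (h : T.pair b α = 1) :
    T.pair b β = 0 := by
  obtain ⟨E, f, g, -, -, hfa, hP, hfix⟩ := exists_nondisturbing hT a hα
  refine le_antisymm ?_ (T.pair_nonneg _ _)
  rw [← comp_eq_of_comp_eq hT hP hb h (hfix α hα), pair_comp, ← hβ]
  exact pair_comp_le hfa _ _ _

/-- An effect that never accepts `α` can be added to the pure effect that accepts `α` with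
certainty: measure the effect without disturbing the states that it never accepts. -/
lemma exists_effectVec_add {A : C} {e b : A ⟶ 𝟙_ C} {α : 𝟙_ C ⟶ A} (hα : T.IsChannel α)
    (he : T.pair e α = 0) (hb : T.IsPure b) (h : T.pair b α = 1) :
    ∃ e' : A ⟶ 𝟙_ C, T.effectVec e' = T.effectVec e + T.effectVec b := by
  obtain ⟨c, -, -, hce⟩ := T.exists_complement e
  have hcα : T.pair (c false) α = 1 := by
    have := pair_add_pair hce α
    rwa [he, zero_add, T.pair_unit_of_isChannel hα] at this
  obtain ⟨E, f, g, hf, hg, hfa, hP, hfix⟩ := exists_nondisturbing hT _ hcα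
  have hPb := comp_eq_of_comp_eq hT hP hb h (hfix α hcα)
  obtain ⟨d, hd, hdb, -⟩ := T.exists_complement b
  obtain ⟨r, -, hr⟩ := T.exists_bool_test (T.isTest_comp _ _ hf (T.isTest_comp _ _ hg hd))
    (fun z => !z.1 || (z.2.1 && z.2.2))
  refine ⟨r true, ?_⟩
  have hsum : ∀ ρ, T.pair (d true) ρ + T.pair (d false) ρ = T.pair (T.unit A) ρ := fun ρ => by
    simpa [effectVec_apply] using congrFun (T.sum_effectVec_of_nonempty hd) ρ
  have hsum' : ∀ ρ, T.pair (T.unit A) (ρ ≫ g true) + T.pair (T.unit A) (ρ ≫ g false) =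
      T.pair (T.unit E) ρ := fun ρ => by
    have := congrFun (T.sum_effectVec_of_nonempty
      ((T.isContext_comp_right (T.isChannel_unit A)).1 _ hg)) ρ
    simpa [effectVec_apply, pair_comp] using this
  have hsum'' : ∀ ρ, T.pair (T.unit E) (ρ ≫ f true) + T.pair (T.unit E) (ρ ≫ f false) =
      T.pair (T.unit A) ρ := fun ρ => by
    have := congrFun (T.sum_effectVec_of_nonempty
      ((T.isContext_comp_right (T.isChannel_unit E)).1 _ hf)) ρ
    simpa [effectVec_apply, pair_comp] using this
  have hr1 := T.vec_effect_sum_one.1 (hr true)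
  rw [hr1, Finset.sum_filter]
  funext ρ
  have h1 := hsum (ρ ≫ f false ≫ g true)
  have h2 := hsum (ρ ≫ f false ≫ g false)
  have h3 := hsum' (ρ ≫ f false)
  have h4 := hsum'' ρ
  have h5 := pair_add_pair hce ρ
  have h6 : T.pair (T.unit E) (ρ ≫ f true) = T.pair (c false) ρ := by rw [← hfa, pair_comp]
  have h7 : T.pair b ρ = T.pair (d true) (ρ ≫ f true ≫ g true) := by
    conv_lhs => rw [← hPb]
    rw [pair_comp, hdb]
  simp only [Category.assoc] at h3
  simp [Fintype.sum_prod_type, effectVec_apply, pair_comp, h7]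
  linarith

/-- The effects that are certain on perfectly distinguishable pure states can be joined. -/
lemma exists_effectVec_eq_sum {A : C} {d : ℕ} {α : Fin d → (𝟙_ C ⟶ A)}
    {a : Fin d → (A ⟶ 𝟙_ C)} (hα : ∀ i, T.IsChannel (α i)) (ha : ∀ i, T.IsPure (a i))
    (h : ∀ i j, T.pair (a i) (α j) = if i = j then 1 else 0) (I : Finset (Fin d)) :
    ∃ e : A ⟶ 𝟙_ C, T.effectVec e = ∑ i ∈ I, T.effectVec (a i) := by
  induction I using Finset.induction with
  | empty =>
    refine ⟨T.unit A ≫ T.scalar ⟨0, by simp⟩, ?_⟩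
    funext ρ
    simp [effectVec, pair_scale_effect]
  | insert j I hj ih =>
    obtain ⟨e, he⟩ := ih
    have h0 : T.pair e (α j) = 0 := by
      have := congrFun he (α j)
      rw [Finset.sum_apply, Finset.sum_eq_zero] at this
      · exact this
      · intro i hi
        exact (h i j).trans (if_neg (by rintro rfl; exact hj hi))
    obtain ⟨e', he'⟩ := exists_effectVec_add hT (hα j) h0 (ha j) ((h j j).trans (if_pos rfl))
    exact ⟨e', by rw [he', he, Finset.sum_insert hj, add_comm]⟩

/-- The orthogonal projectors for the subfamilies of a perfectly distinguishable family of pure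
states. -/
theorem exists_isPure_isOrthogonalProjector {A : C} {d : ℕ} {α : Fin d → (𝟙_ C ⟶ A)}
    (hpure : ∀ i, T.IsPure (α i)) (hα : T.PerfectlyDistinguishable α) :
    ∃ a : Fin d → (A ⟶ 𝟙_ C), (∀ i, T.IsDagger (α i) (a i)) ∧
      ∀ I : Finset (Fin d), ∃ P : A ⟶ A,
        T.IsPure P ∧
        T.IsOrthogonalProjector (∑ i ∈ I, T.effectVec (a i)) P ∧
        T.effectVec (P ≫ T.unit A) = ∑ i ∈ I, T.effectVec (a i) := by
  obtain ⟨m, -, hm⟩ := hα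
  have hα1 : ∀ i, T.IsChannel (α i) := fun i =>
    T.isChannel_of_pair_eq_one ((hm i i).trans (if_pos rfl))
  choose a ha using fun i => exists_isDagger hT (hpure i) (hα1 i)
  have hpair : ∀ i j, T.pair (a i) (α j) = if i = j then 1 else 0 := by
    intro i j
    split_ifs with hij
    · rw [← hij]; exact (ha i).1.2.2
    · exact pair_eq_zero_of_separates hT ((hm i i).trans (if_pos rfl))
        ((hm i j).trans (if_neg hij)) (ha i).1.1 (ha i).1.2.2
  refine ⟨a, ha, fun I => ?_⟩
  obtain ⟨e, he⟩ := exists_effectVec_eq_sum hT hα1 (fun i => (ha i).1.1) hpair I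
  rw [← he]
  rcases I.eq_empty_or_nonempty with rfl | ⟨i₀, hi₀⟩
  · -- the sum is zero, and so is the projector
    let z := scale (T.scalar ⟨0, by simp⟩) A
    have hz : ∀ ρ : 𝟙_ C ⟶ A, T.stateVec (ρ ≫ z) = 0 := fun ρ => by
      simp [z, comp_scale, stateVec_scale]
    have he0 : T.effectVec e = 0 := by rw [he, Finset.sum_empty]
    refine ⟨z, isPure_of_vec_eq_zero ?_, ⟨fun ρ hρ => ?_, fun ρ _ => hz ρ⟩, ?_⟩
    · simpa [z] using T.vec_comp_scale (𝟙 A) (T.scalar ⟨0, by simp⟩)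
    · have : T.effectVec e ρ = 1 := hρ.2
      rw [he0] at this
      exact absurd this (by simp)
    · rw [he0]
      funext ρ
      exact (T.pair_comp z (T.unit A) ρ).trans (congrFun (hz ρ) (T.unit A))
  have hcert : ∀ i ∈ I, T.pair e (α i) = 1 := by
    intro i hi
    have := congrFun he (α i)
    rw [Finset.sum_apply] at this
    refine (this.trans (Finset.sum_eq_single_of_mem i hi fun j _ hj =>
      (hpair j i).trans (if_neg hj))).trans ?_
    exact (ha i).1.2.2
  obtain ⟨E, f, g, -, -, hfe, hP, hfix⟩ := exists_nondisturbing hT e (hcert i₀ hi₀)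
  refine ⟨f true ≫ g true, hP, ⟨fun ρ hρ => hfix ρ hρ.2, fun ρ hρ => ?_⟩, ?_⟩
  · refine T.stateVec_eq_zero_of_unit (le_antisymm ?_ (T.pair_nonneg _ _))
    have h0 : T.pair e ρ = 0 := hρ.2
    exact (pair_comp_le hfe _ _ _).trans_eq h0
  · -- `e` is invariant as a sum of invariant pure effects, so `e ≤ u P`; and `u P ≤ e` always
    have hinv : ∀ ρ, T.pair e (ρ ≫ f true ≫ g true) = T.pair e ρ := by
      intro ρ
      have h1 := congrFun he ρ
      have h2 := congrFun he (ρ ≫ f true ≫ g true)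
      rw [Finset.sum_apply] at h1 h2
      refine h2.trans ((Finset.sum_congr rfl fun i hi => ?_).trans h1.symm)
      have := comp_eq_of_comp_eq hT hP (ha i).1.1 (ha i).1.2.2 (hfix _ (hcert i hi))
      exact (T.pair_comp _ _ ρ).symm.trans (by rw [this]; rfl)
    funext ρ
    refine (T.pair_comp _ _ ρ).trans (le_antisymm (pair_comp_le hfe _ _ _) ?_)
    exact (hinv ρ).symm.le.trans (T.pair_le_unit _ _)

end CausalTheory

end OPT

theorem mainTheorem5 {C : Type u} [Category.{v} C] [MonoidalCategory C] [SymmetricCategory C]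
    (T : OPT.CausalTheory C) (hT : T.IsSharpWithPurification)
    (A : C) (d : ℕ) (α : Fin d → (𝟙_ C ⟶ A)) (hα : T.IsPureMaximal α) :
    ∃ a : Fin d → (A ⟶ 𝟙_ C), (∀ i, T.IsDagger (α i) (a i)) ∧
      ∀ I : Finset (Fin d), ∃ P : A ⟶ A,
        T.IsPure P ∧
        T.IsOrthogonalProjector (∑ i ∈ I, T.effectVec (a i)) P ∧
        T.effectVec (P ≫ T.unit A) = ∑ i ∈ I, T.effectVec (a i) :=
  OPT.CausalTheory.exists_isPure_isOrthogonalProjector hT hα.1 hα.2.1
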